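/- Let $F$ be a non-archimedean local field of odd residue characteristic with ring of integers $O_F$ and maximal ideal $\mathfrak m_F$, and let $\tilde\psi:F\to\mathbb C^*$ be an additive character trivial on $\mathfrak m_F$ and non-trivial on $O_F$. Put $K=F((t))$, $O=F[[t]]$, $G=\mathrm{PGL}_2$, and let $P(K)=K^*\ltimes K\subset G(K)$ be the group of matrices $\begin{pmatrix}a&b\\0&1\end{pmatrix}$. *Smooth representations.* A pro-vector space is a formal limit $V="\varprojlim_l" V_l$ ($l\in\mathbb N$) of complex vector spaces, with $\mathrm{Hom}(V,W)=\varprojlim_l\varinjlim_j\mathrm{Hom}(V_j,W_l)$. For $n\ge 0$ let $X^n\subset G(K)$ be the set of classes of matrices $A$ with $2\min_{i,j} v(a_{ij})-v(\det A)\ge -n$, and let $X^n_m=X^n/G(O)(m+1)$, where $G(O)(m+1)$ is the congruence subgroup modulo $t^{m+1}$, with the topology coming from that of $F$. For a vector space $E$ let $a(X^n,E)=\varinjlim_m\{\text{locally constant functions }X^n_m\to E\}$, and $a(X^n,V)="\varprojlim_l" a(X^n,V_l)$. A representation of $G(K)$ on a pro-vector space $V$ is smooth if it comes from a representation of the group ind-pro-object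 $"\varinjlim_n" X^n$, i.e. from a compatible family of morphisms $V\to a(X^n,V)$, $n\ge0$, satisfying the usual associativity, whose evaluation at each $g\in X^n$ is the action of $g$ on $V$. *The representation $\Upsilon$.* Let $M_n$ be the space of locally constant compactly supported measures on the group $O_n^*=(O/t^{n+1}O)^*$, let $M_{n+1}\to M_n$ be the push-forward, and $\mathbb M="\varprojlim_n" M_n$. The group $O^*\ltimes K$ acts on $\mathbb M$ by a representation $\nu$: $u\in O^*$ acts by shifts, sending the measure with density $h(x)$ with respect to Haar measure to the one with density $h(ux)$, and $b\in K$ acts by multiplication by the function $\phi_b(x)=\tilde\psi(\mathrm{Res}_{t=0}(bx\,dt))$. Then $\Upsilon$ is the representation of $P(K)$ on the pro-vector space $\prod_{n\in\mathbb Z}\mathbb M$ for which $(u,b)\in O^*\ltimes K$ acts on the $n$-th factor by $\nu(u,t^nb)$, and $\begin{pmatrix}t&0\\0&1\end{pmatrix}$ acts by the shift $(f_n)_n\mapsto (f_{n+1})_n$. **Statement.** There is no smooth representation of $G(K)$ on a pro-vector space whose restriction to $P(K)$ is isomorphic to $\Upsilon$. -/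

import Mathlib

open CategoryTheory
open scoped LaurentSeries PowerSeries MatrixGroups ValuativeRel PowerSeries.WithPiTopology Topology

universe u

noncomputable section

/-- A (countable) pro-vector space over `ℂ`: a projective system
`… → V₂ → V₁ → V₀` of complex vector spaces, regarded as its formal limit. -/
structure ProVect : Type (u + 1) where
  obj : ℕ → Type u
  [addCommGroup : ∀ j, AddCommGroup (obj j)]
  [module : ∀ j, Module ℂ (obj j)]
  map : ∀ {i j : ℕ}, i ≤ j → obj j →ₗ[ℂ] obj i
  map_id : ∀ i, map (le_refl i) = LinearMap.id
  map_comp : ∀ {i j k : ℕ} (hij : i ≤ j) (hjk : j ≤ k), map hij ∘ₗ map hjk = map (hij.trans hjk)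

attribute [instance] ProVect.addCommGroup ProVect.module

namespace ProVect

/-- Morphisms from the pro-vector space `V` to a vector space `E`: `colim_j Hom(V_j, E)`. -/
abbrev Germ (V : ProVect.{u}) (E : Type u) [AddCommGroup E] [Module ℂ E] : Type u :=
  Module.DirectLimit (fun j => V.obj j →ₗ[ℂ] E)
    (fun _ _ h => LinearMap.lcomp ℂ E (V.map h))

namespace Germ

variable {V : ProVect.{u}} {E E' E'' : Type u} [AddCommGroup E] [Module ℂ E]
  [AddCommGroup E'] [Module ℂ E'] [AddCommGroup E''] [Module ℂ E'']

/-- The morphism represented by a linear map on the `j`-th term. -/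
def of (j : ℕ) : (V.obj j →ₗ[ℂ] E) →ₗ[ℂ] Germ V E :=
  Module.DirectLimit.of ℂ ℕ (fun j => V.obj j →ₗ[ℂ] E)
    (fun _ _ h => LinearMap.lcomp ℂ E (V.map h)) j

theorem of_map {i j : ℕ} (h : i ≤ j) (f : V.obj i →ₗ[ℂ] E) :
    (of j (f ∘ₗ V.map h) : Germ V E) = of i f :=
  Module.DirectLimit.of_f (f := fun _ _ h => LinearMap.lcomp ℂ E (V.map h)) (hij := h) (x := f)

theorem exists_of (x : Germ V E) : ∃ j f, of j f = x :=
  Module.DirectLimit.exists_of x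

/-- Composition of a morphism `V ⟶ E` with a linear map `E → E'`. -/
def post (p : E →ₗ[ℂ] E') : Germ V E →ₗ[ℂ] Germ V E' :=
  Module.DirectLimit.map (fun _ => LinearMap.llcomp ℂ _ E E' p) (fun _ _ _ => rfl)

@[simp] theorem post_of (p : E →ₗ[ℂ] E') (j : ℕ) (f : V.obj j →ₗ[ℂ] E) :
    post p (of j f) = of j (p ∘ₗ f) :=
  (Module.DirectLimit.map_apply_of (f := fun _ _ h => LinearMap.lcomp ℂ E (V.map h))
    (f' := fun _ _ h => LinearMap.lcomp ℂ E' (V.map h)) _ _ f)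

@[simp] theorem post_id (x : Germ V E) : post LinearMap.id x = x := by
  obtain ⟨j, f, rfl⟩ := exists_of x
  simp

@[simp] theorem post_post (q : E' →ₗ[ℂ] E'') (p : E →ₗ[ℂ] E') (x : Germ V E) :
    post q (post p x) = post (q ∘ₗ p) x := by
  obtain ⟨j, f, rfl⟩ := exists_of x
  simp [LinearMap.comp_assoc]

end Germ

/-- Morphisms of pro-vector spaces: `Hom(V, W) = lim_l colim_j Hom(V_j, W_l)`. -/
@[ext] structure Hom (V W : ProVect.{u}) : Type u where
  germ : ∀ l, Germ V (W.obj l)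
  compat : ∀ {k l : ℕ} (h : k ≤ l), Germ.post (W.map h) (germ l) = germ k

/-- Composition of a morphism `V ⟶ W` of pro-vector spaces with a morphism from `W` to a
vector space. -/
def Hom.pre {V W : ProVect.{u}} (φ : Hom V W) (E : Type u) [AddCommGroup E] [Module ℂ E] :
    Germ W E →ₗ[ℂ] Germ V E :=
  Module.DirectLimit.lift ℂ ℕ (fun l => W.obj l →ₗ[ℂ] E)
    (fun _ _ h => LinearMap.lcomp ℂ E (W.map h))
    (fun l =>
      { toFun := fun f => Germ.post f (φ.germ l)
        map_add' := fun f g => by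
          obtain ⟨j, x, hx⟩ := Germ.exists_of (φ.germ l)
          rw [← hx]
          simp only [Germ.post_of, LinearMap.add_comp, map_add]
        map_smul' := fun c f => by
          obtain ⟨j, x, hx⟩ := Germ.exists_of (φ.germ l)
          rw [← hx]
          simp only [Germ.post_of, LinearMap.smul_comp, map_smul, RingHom.id_apply] })
    (fun i j h f => by
      change Germ.post (f ∘ₗ W.map h) (φ.germ j) = Germ.post f (φ.germ i)
      rw [← φ.compat h, Germ.post_post])

@[simp] theorem Hom.pre_of {V W : ProVect.{u}} (φ : Hom V W) {E : Type u} [AddCommGroup E]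
    [Module ℂ E] (l : ℕ) (f : W.obj l →ₗ[ℂ] E) :
    φ.pre E (Germ.of l f) = Germ.post f (φ.germ l) :=
  Module.DirectLimit.lift_of (f := fun _ _ h => LinearMap.lcomp ℂ E (W.map h)) _ _ f

theorem Hom.pre_post {V W : ProVect.{u}} (φ : Hom V W) {E E' : Type u} [AddCommGroup E]
    [Module ℂ E] [AddCommGroup E'] [Module ℂ E'] (p : E →ₗ[ℂ] E') (x : Germ W E) :
    φ.pre E' (Germ.post p x) = Germ.post p (φ.pre E x) := by
  obtain ⟨j, f, rfl⟩ := Germ.exists_of x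
  simp

/-- The category of pro-vector spaces. -/
instance : Category ProVect.{u} where
  Hom := Hom
  id V := ⟨fun l => Germ.of l LinearMap.id, fun {k l} h => by
    rw [Germ.post_of, LinearMap.comp_id, ← Germ.of_map h, LinearMap.id_comp]⟩
  comp φ χ := ⟨fun l => φ.pre _ (χ.germ l), fun h => by rw [← Hom.pre_post, χ.compat h]⟩
  id_comp φ := by
    refine Hom.ext (funext fun l => ?_)
    obtain ⟨j, f, hf⟩ := Germ.exists_of (φ.germ l)
    simp [← hf]
  comp_id φ := by
    refine Hom.ext (funext fun l => ?_)
    simp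
  assoc φ χ ω := by
    refine Hom.ext (funext fun l => ?_)
    obtain ⟨j, f, hf⟩ := Germ.exists_of (ω.germ l)
    simp [← hf, Hom.pre_post]

theorem hom_ext {V W : ProVect.{u}} {φ χ : V ⟶ W}
    (h : ∀ l, Hom.germ φ l = Hom.germ χ l) : φ = χ :=
  Hom.ext (funext h)

/-- The product `∏_{n ∈ ℤ} V` of copies of `V`, in the category of pro-vector spaces: the
formal limit over `r` of the finite products `∏_{|n| ≤ r} V_r`. -/
def prodInt (V : ProVect.{u}) : ProVect.{u} where
  obj r := {n : ℤ // n.natAbs ≤ r} → V.obj r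
  map {i j} h :=
    { toFun := fun D n => V.map h (D ⟨n.1, n.2.trans h⟩)
      map_add' := fun _ _ => by ext; simp
      map_smul' := fun _ _ => by ext; simp }
  map_id i := by
    apply LinearMap.ext; intro D; funext n
    simp [V.map_id]
  map_comp hij hjk := by
    apply LinearMap.ext; intro D; funext n
    simp [← V.map_comp hij hjk]

end ProVect

section LocalField

open HahnSeries

variable {F : Type u} [Field F]

/-- The function `φ_c(y) = ψ(c y) = ψ₀(Res (c y dt))` on `O^*`. -/
def phi (ψ₀ : AddChar F ℂ) (c : F⸨X⸩) (y : F⟦X⟧ˣ) : ℂ :=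
  ψ₀ ((c * ((y : F⟦X⟧) : F⸨X⸩)).coeff (-1))

theorem coeff_neg_one_single_mul (m : ℕ) (d : F⟦X⟧) :
    ((single (-((m : ℤ) + 1)) (1 : F)) * (d : F⸨X⸩)).coeff (-1) = PowerSeries.coeff m d := by
  have := HahnSeries.coeff_single_mul_add (r := (1 : F)) (x := (d : F⸨X⸩)) (a := (m : ℤ))
    (b := -((m : ℤ) + 1))
  rw [show (m : ℤ) + -((m : ℤ) + 1) = -1 by ring] at this
  rw [this, one_mul]
  simp

/-- `c ∈ t^{-(m+1)} O`. -/
def PoleLE (c : F⸨X⸩) (m : ℕ) : Prop := ∃ d : F⟦X⟧, c = single (-((m : ℤ) + 1)) (1 : F) * d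

theorem PoleLE.of_order {c : F⸨X⸩} {m : ℕ} (h : -((m : ℤ) + 1) ≤ c.order) : PoleLE c m := by
  refine ⟨PowerSeries.X ^ (c.order + (m + 1)).toNat * c.powerSeriesPart, ?_⟩
  have h1 := c.single_order_mul_powerSeriesPart
  have h2 : (((PowerSeries.X : F⟦X⟧) ^ (c.order + (m + 1)).toNat : F⟦X⟧) : F⸨X⸩)
      = single (c.order + (m + 1)) 1 := by
    rw [HahnSeries.ofPowerSeries_X_pow, Int.toNat_of_nonneg (by omega)]
  rw [map_mul, h2, ← mul_assoc, HahnSeries.single_mul_single]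
  rw [mul_one, show -((m : ℤ) + 1) + (c.order + (m + 1)) = c.order by ring, h1]

theorem PoleLE.single_mul {b : F⸨X⸩} {n : ℤ} {m : ℕ} (h : n.natAbs + b.order.natAbs ≤ m) :
    PoleLE (single n (1 : F) * b) m := by
  by_cases hb : b = 0
  · exact ⟨0, by simp [hb]⟩
  · apply PoleLE.of_order
    rw [HahnSeries.order_mul (by simp) hb, HahnSeries.order_single one_ne_zero]
    omega

theorem phi_eq (ψ₀ : AddChar F ℂ) (d : F⟦X⟧) (m : ℕ) (y : F⟦X⟧ˣ) :
    phi ψ₀ (single (-((m : ℤ) + 1)) (1 : F) * d) y = ψ₀ (PowerSeries.coeff m (d * y)) := by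
  rw [phi, mul_assoc, ← map_mul, coeff_neg_one_single_mul]

/-- The unit `t^{-v(a)} a ∈ O^*` attached to `a ∈ K^*`. -/
def unitPart (a : F⸨X⸩ˣ) : F⟦X⟧ˣ :=
  Units.mkOfMulEqOne (a : F⸨X⸩).powerSeriesPart ((a⁻¹ : F⸨X⸩ˣ) : F⸨X⸩).powerSeriesPart (by
    apply HahnSeries.ofPowerSeries_injective (Γ := ℤ) (R := F)
    rw [map_mul, LaurentSeries.ofPowerSeries_powerSeriesPart,
      LaurentSeries.ofPowerSeries_powerSeriesPart, mul_mul_mul_comm, Units.mul_inv,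
      mul_one, HahnSeries.single_mul_single, map_one (HahnSeries.ofPowerSeries ℤ F)]
    have h := HahnSeries.order_mul a.ne_zero (a⁻¹).ne_zero
    rw [Units.mul_inv, HahnSeries.order_one] at h
    rw [show -(a : F⸨X⸩).order + -((a⁻¹ : F⸨X⸩ˣ) : F⸨X⸩).order = 0 by omega, mul_one]
    rfl)

theorem coe_unitPart (a : F⸨X⸩ˣ) :
    (((unitPart a : F⟦X⟧ˣ) : F⟦X⟧) : F⸨X⸩) =
      single (-(a : F⸨X⸩).order) (1 : F) * (a : F⸨X⸩) :=
  LaurentSeries.ofPowerSeries_powerSeriesPart _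

theorem order_units_mul (a b : F⸨X⸩ˣ) :
    ((a * b : F⸨X⸩ˣ) : F⸨X⸩).order = (a : F⸨X⸩).order + (b : F⸨X⸩).order :=
  HahnSeries.order_mul a.ne_zero b.ne_zero

theorem unitPart_mul (a b : F⸨X⸩ˣ) : unitPart (a * b) = unitPart a * unitPart b := by
  ext1
  apply HahnSeries.ofPowerSeries_injective (Γ := ℤ) (R := F)
  rw [coe_unitPart, order_units_mul, Units.val_mul, Units.val_mul, map_mul, coe_unitPart,
    coe_unitPart, mul_mul_mul_comm, HahnSeries.single_mul_single, neg_add, mul_one]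

theorem unitPart_one : unitPart (1 : F⸨X⸩ˣ) = 1 := by
  ext1
  apply HahnSeries.ofPowerSeries_injective (Γ := ℤ) (R := F)
  rw [coe_unitPart]
  simp

/-- The group `P(K) = K^* ⋉ K` of matrices `(a b; 0 1)`, for a field `K`. -/
@[ext] structure BorelPGL (K : Type u) [Field K] where
  a : Kˣ
  b : K

namespace BorelPGL

variable {K : Type u} [Field K]

instance : Mul (BorelPGL K) := ⟨fun p q => ⟨p.a * q.a, p.a * q.b + p.b⟩⟩

instance : One (BorelPGL K) := ⟨⟨1, 0⟩⟩

instance : Inv (BorelPGL K) := ⟨fun p => ⟨p.a⁻¹, -(↑(p.a⁻¹) * p.b)⟩⟩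

@[simp] theorem mul_a (p q : BorelPGL K) : (p * q).a = p.a * q.a := rfl
@[simp] theorem mul_b (p q : BorelPGL K) : (p * q).b = p.a * q.b + p.b := rfl
@[simp] theorem one_a : (1 : BorelPGL K).a = 1 := rfl
@[simp] theorem one_b : (1 : BorelPGL K).b = 0 := rfl
@[simp] theorem inv_a (p : BorelPGL K) : p⁻¹.a = p.a⁻¹ := rfl
@[simp] theorem inv_b (p : BorelPGL K) : p⁻¹.b = -(↑(p.a⁻¹) * p.b) := rfl

instance : Group (BorelPGL K) :=
  Group.ofLeftAxioms
    (fun p q r => by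
      ext
      · simp [mul_assoc]
      · simp only [mul_b, mul_a, Units.val_mul]; ring)
    (fun p => by ext <;> simp)
    (fun p => by ext <;> simp)

/-- The matrix `(a b; 0 1)` of `GL₂(K)`. -/
def toGL : BorelPGL K →* GL (Fin 2) K where
  toFun p := Matrix.GeneralLinearGroup.mkOfDetNeZero !![(p.a : K), p.b; 0, 1] (by simp)
  map_one' := by
    ext i j
    fin_cases i <;> fin_cases j <;> simp [Matrix.GeneralLinearGroup.mkOfDetNeZero]
  map_mul' p q := by
    ext i j
    fin_cases i <;> fin_cases j <;>
      simp [Matrix.GeneralLinearGroup.mkOfDetNeZero, Matrix.mul_apply, Fin.sum_univ_two]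

/-- The inclusion of `P(K)` into `G(K) = PGL₂(K)`. -/
def toPGL : BorelPGL K →* PGL(2, K) := Matrix.ProjGenLinGroup.mk.comp toGL

end BorelPGL

variable (F) [TopologicalSpace F]

/-- Locally constant functions on `O_n^* = O^* / O^*(n+1)`, where `O = F⟦t⟧`, viewed as functions
on `O^*`. The topology of `O^*` is the one given by the coefficients. -/
def LCFun (n : ℕ) : Submodule ℂ (F⟦X⟧ˣ → ℂ) where
  carrier := {f | IsLocallyConstant f ∧
    ∀ x u : F⟦X⟧ˣ, PowerSeries.X ^ (n + 1) ∣ (u : F⟦X⟧) - 1 → f (x * u) = f x}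
  zero_mem' := ⟨IsLocallyConstant.const 0, fun _ _ _ => rfl⟩
  add_mem' := fun {f g} hf hg => ⟨hf.1.add hg.1, fun x u h => by simp [hf.2 x u h, hg.2 x u h]⟩
  smul_mem' := fun c f hf => ⟨hf.1.comp (fun z => c * z), fun x u h => by simp [hf.2 x u h]⟩

variable {F}

theorem LCFun.mono {m n : ℕ} (h : m ≤ n) : LCFun F m ≤ LCFun F n := fun _ hf =>
  ⟨hf.1, fun x u hu => hf.2 x u ((pow_dvd_pow _ (by omega)).trans hu)⟩

variable [IsTopologicalRing F]

/-- The translate `x ↦ f (u x)`. -/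
def lcShift {n : ℕ} (u : F⟦X⟧ˣ) (f : LCFun F n) : LCFun F n :=
  ⟨fun x => f.1 (u * x), f.2.1.comp_continuous (continuous_const_mul u), fun x w hw => by
    simpa [mul_assoc] using f.2.2 (u * x) w hw⟩

variable (F)

/-- Locally constant compactly supported measures on the group `O_n^*`, viewed as linear
functionals on the locally constant functions: those functionals that are supported on a compact
set and are invariant under translations from a neighbourhood of `1`. -/
def LCMeas (n : ℕ) : Submodule ℂ (LCFun F n →ₗ[ℂ] ℂ) where
  carrier := {D | (∀ᶠ u in 𝓝 (1 : F⟦X⟧ˣ), ∀ f, D (lcShift u f) = D f) ∧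
    ∃ C : Set F⟦X⟧ˣ, IsCompact C ∧ ∀ f : LCFun F n, (∀ x ∈ C, f.1 x = 0) → D f = 0}
  zero_mem' := ⟨by simp, ∅, isCompact_empty, by simp⟩
  add_mem' := by
    rintro D E ⟨hD, C, hC, hDC⟩ ⟨hE, C', hC', hEC⟩
    refine ⟨?_, C ∪ C', hC.union hC', fun f hf => ?_⟩
    · filter_upwards [hD, hE] with u h1 h2 f
      simp [h1, h2]
    · simp [hDC f (fun x hx => hf x (Or.inl hx)), hEC f (fun x hx => hf x (Or.inr hx))]
  smul_mem' := by
    rintro c D ⟨hD, C, hC, hDC⟩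
    refine ⟨?_, C, hC, fun f hf => by simp [hDC f hf]⟩
    filter_upwards [hD] with u h1 f
    simp [h1]

/-- The pro-vector space `𝕄 = lim_n M_n`, where `M_n` is the space of locally constant compactly
supported measures on `O_n^*` and `M_{n+1} → M_n` is the push-forward. -/
def MM : ProVect.{u} where
  obj n := LCMeas F n
  map {i j} h :=
    { toFun := fun D => ⟨D.1 ∘ₗ Submodule.inclusion (LCFun.mono h), by
        obtain ⟨D, hD, C, hC, hDC⟩ := D
        refine ⟨?_, C, hC, fun f hf => hDC (Submodule.inclusion (LCFun.mono h) f) hf⟩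
        filter_upwards [hD] with u h1 f
        exact h1 (Submodule.inclusion (LCFun.mono h) f)⟩
      map_add' := fun _ _ => rfl
      map_smul' := fun _ _ => rfl }
  map_id _ := rfl
  map_comp _ _ := rfl

variable {F}

theorem phi_mem {ψ₀ : AddChar F ℂ} (hψ : IsLocallyConstant ψ₀) {c : F⸨X⸩} {m : ℕ}
    (hc : PoleLE c m) : phi ψ₀ c ∈ LCFun F m := by
  obtain ⟨d, rfl⟩ := hc
  constructor
  · have : phi ψ₀ (single (-((m : ℤ) + 1)) (1 : F) * (d : F⸨X⸩)) =
        fun y : F⟦X⟧ˣ => ψ₀ (PowerSeries.coeff m (d * y)) := funext fun y => phi_eq ψ₀ d m y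
    rw [this]
    exact hψ.comp_continuous ((PowerSeries.WithPiTopology.continuous_coeff F m).comp
      (continuous_const.mul Units.continuous_val))
  · rintro x u ⟨e, he⟩
    rw [phi_eq, phi_eq, Units.val_mul, show (u : F⟦X⟧) = 1 + PowerSeries.X ^ (m + 1) * e by
      rw [← he]; ring]
    congr 1
    rw [show d * ((x : F⟦X⟧) * (1 + PowerSeries.X ^ (m + 1) * e)) =
      d * (x : F⟦X⟧) + PowerSeries.X ^ (m + 1) * (d * (x : F⟦X⟧) * e) by ring, map_add,
      PowerSeries.coeff_X_pow_mul', if_neg (by omega), add_zero]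

/-- The effect of `(u, c) ∈ O^* ⋉ K` on test functions. -/
def LCFun.twist {ψ₀ : AddChar F ℂ} (hψ : IsLocallyConstant ψ₀) (u : F⟦X⟧ˣ) (c : F⸨X⸩)
    {l m : ℕ} (hlm : l ≤ m) (hc : PoleLE c m) : LCFun F l →ₗ[ℂ] LCFun F m where
  toFun f := ⟨fun y => phi ψ₀ c (u⁻¹ * y) * f.1 (u⁻¹ * y),
    ((phi_mem hψ hc).1.mul f.2.1).comp_continuous (continuous_const_mul u⁻¹), fun x w hw => by
      beta_reduce
      rw [← mul_assoc, (phi_mem hψ hc).2 _ w hw, (LCFun.mono hlm f.2).2 _ w hw]⟩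
  map_add' f g := by ext; simp [mul_add]
  map_smul' r f := by ext; simp; ring

/-- The operator `ν(u, c)`, `u ∈ O^*`, `c ∈ K`: the element `u` shifts measures and `c` multiplies
them by `φ_c`; it is given by a map `M_m → M_l` as soon as `l ≤ m` and `c ∈ t^{-(m+1)} O`. -/
def nuMap {ψ₀ : AddChar F ℂ} (hψ : IsLocallyConstant ψ₀) (u : F⟦X⟧ˣ) (c : F⸨X⸩)
    {l m : ℕ} (hlm : l ≤ m) (hc : PoleLE c m) : LCMeas F m →ₗ[ℂ] LCMeas F l where
  toFun D := ⟨D.1 ∘ₗ LCFun.twist hψ u c hlm hc, by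
    obtain ⟨D, hD, C, hC, hDC⟩ := D
    constructor
    · have hloc : ∀ᶠ w in 𝓝 (1 : F⟦X⟧ˣ), ∀ y ∈ C,
          phi ψ₀ c (u⁻¹ * (w * y)) = phi ψ₀ c (u⁻¹ * y) := by
        refine hC.eventually_forall_of_forall_eventually fun y _ => ?_
        have hcont : Continuous fun z : F⟦X⟧ˣ × F⟦X⟧ˣ => u⁻¹ * (z.1 * z.2) := by fun_prop
        have h1 := ((phi_mem hψ hc).1.comp_continuous hcont).eventually_eq (1, y)
        have hcont' : Continuous fun z : F⟦X⟧ˣ × F⟦X⟧ˣ => u⁻¹ * z.2 := by fun_prop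
        have h2 := ((phi_mem hψ hc).1.comp_continuous hcont').eventually_eq (1, y)
        filter_upwards [h1, h2] with z hz1 hz2
        simp only [Function.comp, one_mul] at hz1 hz2
        rw [hz1, hz2]
      filter_upwards [hD, hloc] with w hw1 hw2 f
      rw [LinearMap.comp_apply, LinearMap.comp_apply, ← hw1 (LCFun.twist hψ u c hlm hc f),
        ← sub_eq_zero, ← map_sub]
      refine hDC _ fun y hy => ?_
      change phi ψ₀ c (u⁻¹ * y) * f.1 (w * (u⁻¹ * y)) -
        phi ψ₀ c (u⁻¹ * (w * y)) * f.1 (u⁻¹ * (w * y)) = 0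
      rw [hw2 y hy, mul_left_comm w u⁻¹ y, sub_self]
    · refine ⟨(fun y => u⁻¹ * y) '' C, hC.image (continuous_const_mul u⁻¹), fun f hf => ?_⟩
      refine hDC _ fun y hy => ?_
      change phi ψ₀ c (u⁻¹ * y) * f.1 (u⁻¹ * y) = 0
      rw [hf _ ⟨y, hy, rfl⟩, mul_zero]⟩
  map_add' _ _ := rfl
  map_smul' _ _ := rfl


/-- The element `p = (a, b)` of `P(K)`, `a = t^k u` with `u ∈ O^*`, acts on `∏_{n ∈ ℤ} 𝕄` by
`(p D)_n = ν(u, t^n b) D_{n + k}`. In particular `p ∈ O^* ⋉ K` acts on the `n`-th factor through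
`ν ∘ α_n`, where `α_n(u, b) = (u, t^n b)` is the conjugation by `(t^n, 0)`, and `(t, 0)` acts by
the shift of the factors. The following are the components of this operator. -/
def upsilonMap {ψ₀ : AddChar F ℂ} (hψ : IsLocallyConstant ψ₀) (p : BorelPGL F⸨X⸩) (l j : ℕ)
    (h : l + (p.a : F⸨X⸩).order.natAbs + p.b.order.natAbs ≤ j) :
    (MM F).prodInt.obj j →ₗ[ℂ] (MM F).prodInt.obj l where
  toFun D n := nuMap hψ (unitPart p.a) (single n.1 1 * p.b) (l := l) (m := j) (by omega)
    (PoleLE.single_mul (by have := n.2; omega))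
    (D ⟨n.1 + (p.a : F⸨X⸩).order, by have := n.2; omega⟩)
  map_add' _ _ := by funext n; exact map_add _ _ _
  map_smul' _ _ := by funext n; exact LinearMap.map_smul (nuMap hψ _ _ _ _) _ _

theorem prodInt_congr {j : ℕ} (D : (MM F).prodInt.obj j) {n n' : {n : ℤ // n.natAbs ≤ j}}
    (h : n.1 = n'.1) {f f' : LCFun F j} (hf : ∀ y, f.1 y = f'.1 y) :
    (D n).1 f = (D n').1 f' := by
  obtain rfl : n = n' := Subtype.ext h
  obtain rfl : f = f' := Subtype.ext (funext hf)
  rfl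

theorem upsilonMap_comp_map {ψ₀ : AddChar F ℂ} (hψ : IsLocallyConstant ψ₀) (p : BorelPGL F⸨X⸩)
    {l i j : ℕ} (h : l + (p.a : F⸨X⸩).order.natAbs + p.b.order.natAbs ≤ i) (hij : i ≤ j) :
    upsilonMap hψ p l i h ∘ₗ (MM F).prodInt.map hij = upsilonMap hψ p l j (h.trans hij) := rfl

theorem map_comp_upsilonMap {ψ₀ : AddChar F ℂ} (hψ : IsLocallyConstant ψ₀) (p : BorelPGL F⸨X⸩)
    {k l j : ℕ} (h : l + (p.a : F⸨X⸩).order.natAbs + p.b.order.natAbs ≤ j) (hkl : k ≤ l) :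
    (MM F).prodInt.map hkl ∘ₗ upsilonMap hψ p l j h = upsilonMap hψ p k j (by omega) := rfl

theorem upsilonMap_one {ψ₀ : AddChar F ℂ} (hψ : IsLocallyConstant ψ₀) {l j : ℕ} (hlj : l ≤ j)
    (h : l + ((1 : BorelPGL F⸨X⸩).a : F⸨X⸩).order.natAbs + (1 : BorelPGL F⸨X⸩).b.order.natAbs ≤ j) :
    upsilonMap hψ 1 l j h = (MM F).prodInt.map hlj := by
  apply LinearMap.ext; intro D; funext n
  apply Subtype.ext
  apply LinearMap.ext; intro f
  refine prodInt_congr D (by simp) fun y => ?_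
  change phi ψ₀ (single n.1 1 * 0) ((unitPart 1)⁻¹ * y) * f.1 ((unitPart 1)⁻¹ * y) = f.1 y
  simp [unitPart_one, phi]

theorem upsilonMap_mul {ψ₀ : AddChar F ℂ} (hψ : IsLocallyConstant ψ₀) (p q : BorelPGL F⸨X⸩)
    {l i j : ℕ} (hp : l + (p.a : F⸨X⸩).order.natAbs + p.b.order.natAbs ≤ i)
    (hq : i + (q.a : F⸨X⸩).order.natAbs + q.b.order.natAbs ≤ j)
    (hpq : l + ((p * q).a : F⸨X⸩).order.natAbs + (p * q).b.order.natAbs ≤ j) :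
    upsilonMap hψ (p * q) l j hpq = upsilonMap hψ p l i hp ∘ₗ upsilonMap hψ q i j hq := by
  apply LinearMap.ext; intro D; funext n
  apply Subtype.ext
  apply LinearMap.ext; intro f
  refine prodInt_congr D ?_ fun y => ?_
  · change n.1 + ((p.a * q.a : F⸨X⸩ˣ) : F⸨X⸩).order = n.1 + _ + _
    rw [order_units_mul, add_assoc]
  · change phi ψ₀ (single n.1 1 * ((p.a : F⸨X⸩) * q.b + p.b)) ((unitPart (p.a * q.a))⁻¹ * y) *
        f.1 ((unitPart (p.a * q.a))⁻¹ * y) =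
      phi ψ₀ (single (n.1 + (p.a : F⸨X⸩).order) 1 * q.b) ((unitPart q.a)⁻¹ * y) *
        (phi ψ₀ (single n.1 1 * p.b) ((unitPart p.a)⁻¹ * ((unitPart q.a)⁻¹ * y)) *
          f.1 ((unitPart p.a)⁻¹ * ((unitPart q.a)⁻¹ * y)))
    rw [unitPart_mul, mul_inv, mul_assoc, ← mul_assoc (phi _ _ _) (phi _ _ _)]
    congr 1
    set z := (unitPart q.a)⁻¹ * y with hz
    rw [phi, phi, phi, ← AddChar.map_add_eq_mul, ← HahnSeries.coeff_add]
    congr 2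
    have h1 : ((z : F⟦X⟧) : F⸨X⸩) = ((unitPart p.a : F⟦X⟧) : F⸨X⸩) *
        ((((unitPart p.a)⁻¹ * z : F⟦X⟧ˣ) : F⟦X⟧) : F⸨X⸩) := by
      rw [← map_mul, ← Units.val_mul, mul_inv_cancel_left]
    rw [h1, coe_unitPart]
    have h2 : (single n.1 (1 : F) : F⸨X⸩) =
        single (n.1 + (p.a : F⸨X⸩).order) 1 * single (-(p.a : F⸨X⸩).order) 1 := by
      rw [HahnSeries.single_mul_single, mul_one, add_neg_cancel_right]
    rw [mul_add, h2]
    ring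

/-- The action of an element of `P(K)` on the pro-vector space `∏_{n ∈ ℤ} 𝕄`. -/
def upsilonHom {ψ₀ : AddChar F ℂ} (hψ : IsLocallyConstant ψ₀) (p : BorelPGL F⸨X⸩) :
    (MM F).prodInt ⟶ (MM F).prodInt where
  germ l := ProVect.Germ.of _ (upsilonMap hψ p l _ le_rfl)
  compat {k l} h := by
    rw [ProVect.Germ.post_of, map_comp_upsilonMap, ← upsilonMap_comp_map hψ p le_rfl (by omega),
      ProVect.Germ.of_map]

theorem upsilonHom_germ {ψ₀ : AddChar F ℂ} (hψ : IsLocallyConstant ψ₀) (p : BorelPGL F⸨X⸩)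
    {l j : ℕ} (h : l + (p.a : F⸨X⸩).order.natAbs + p.b.order.natAbs ≤ j) :
    ProVect.Hom.germ (upsilonHom hψ p) l = ProVect.Germ.of j (upsilonMap hψ p l j h) := by
  rw [← upsilonMap_comp_map hψ p le_rfl h, ProVect.Germ.of_map]
  rfl

/-- The representation `Υ` of `P(K)`. -/
def Upsilon {ψ₀ : AddChar F ℂ} (hψ : IsLocallyConstant ψ₀) :
    Action ProVect.{u} (BorelPGL F⸨X⸩) where
  V := (MM F).prodInt
  ρ :=
    { toFun := fun p => End.of (upsilonHom hψ p)
      map_one' := by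
        refine ProVect.hom_ext fun l => ?_
        rw [upsilonHom_germ hψ 1 le_rfl, upsilonMap_one hψ (by omega)]
        exact ProVect.Germ.of_map (V := (MM F).prodInt) (by omega) LinearMap.id
      map_mul' := fun p q => by
        refine ProVect.hom_ext fun l => ?_
        let i := l + (p.a : F⸨X⸩).order.natAbs + p.b.order.natAbs
        let j := max (i + (q.a : F⸨X⸩).order.natAbs + q.b.order.natAbs)
          (l + ((p * q).a : F⸨X⸩).order.natAbs + (p * q).b.order.natAbs)
        rw [upsilonHom_germ hψ (p * q) (j := j) (le_max_right _ _),
          upsilonMap_mul hψ p q (i := i) le_rfl (le_max_left _ _)]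
        change _ = (upsilonHom hψ q).pre _ (ProVect.Hom.germ (upsilonHom hψ p) l)
        rw [upsilonHom_germ hψ p (j := i) le_rfl, ProVect.Hom.pre_of,
          upsilonHom_germ hψ q (j := j) (le_max_left _ _), ProVect.Germ.post_of] }


theorem isLocallyConstant_of_trivial {F : Type u} [Field F] [ValuativeRel F] [TopologicalSpace F]
    [IsNonarchimedeanLocalField F] {ψ₀ : AddChar F ℂ}
    (h : ∀ x, ValuativeRel.valuation F x < 1 → ψ₀ x = 1) : IsLocallyConstant ψ₀ := by
  rw [IsLocallyConstant.iff_eventually_eq]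
  intro x
  have h0 : ∀ᶠ z in 𝓝 (0 : F), ValuativeRel.valuation F z < 1 := by
    refine (IsValuativeTopology.hasBasis_nhds_zero' F).mem_of_mem (i := 1) one_ne_zero
  have h1 : Filter.Tendsto (fun y : F => y - x) (𝓝 x) (𝓝 0) := by
    simpa using (continuous_sub_right x).tendsto x
  filter_upwards [h1.eventually h0] with y hy
  rw [← sub_add_cancel y x, AddChar.map_add_eq_mul, h _ hy, one_mul]

end LocalField

section LoopGroup

open HahnSeries Matrix

variable (F : Type u) [Field F]

/-- The bounded piece `X^n` of `G(K) = PGL₂(K)`: the classes of the matrices `A` with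
`2 min_{i,j} v(a_{ij}) - v(det A) ≥ -n`. -/
def bddPiece (n : ℕ) : Set PGL(2, F⸨X⸩) :=
  ProjGenLinGroup.mk '' {A : GL (Fin 2) F⸨X⸩ |
    ∀ i j, A i j = 0 ∨ (A : Matrix (Fin 2) (Fin 2) F⸨X⸩).det.order - n ≤ 2 * (A i j).order}

/-- The `N`-th congruence subgroup of `G(O)`, `N ≥ 1`: the classes of the matrices `A` with
`A ≡ 1` modulo `t^N`. -/
def congruence (N : ℕ) : Set PGL(2, F⸨X⸩) :=
  ProjGenLinGroup.mk '' {A : GL (Fin 2) F⸨X⸩ |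
    ∀ i j, ∃ d : F⟦X⟧, A i j - (1 : Matrix (Fin 2) (Fin 2) F⸨X⸩) i j =
      ((PowerSeries.X ^ N * d : F⟦X⟧) : F⸨X⸩)}

variable [TopologicalSpace F]

/-- The topology of `G(K)` (to be used on the bounded pieces `X^n`) coming from the topology of
`F`: it is given by the coefficients of the generators `a_{ij} a_{kl} / det A` of the coordinate
ring of `PGL₂`. -/
@[reducible] def loopTopology : TopologicalSpace PGL(2, F⸨X⸩) :=
  TopologicalSpace.coinduced ProjGenLinGroup.mk
    (TopologicalSpace.induced
      (fun (A : GL (Fin 2) F⸨X⸩) (i j k l : Fin 2) (p : ℤ) =>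
        (A i j * A k l * ((A : Matrix (Fin 2) (Fin 2) F⸨X⸩).det)⁻¹).coeff p)
      inferInstance)

/-- The vector space `a(X^n, E) = colim_m a(X^n_m, E)`, where `X^n_m = X^n / G(O)(m+1)` and
`a(X^n_m, E)` is the space of locally constant `E`-valued functions on `X^n_m`. -/
def SmoothFun (n : ℕ) (E : Type u) [AddCommGroup E] [Module ℂ E] :
    Submodule ℂ (bddPiece F n → E) where
  carrier := {f |
    (letI := loopTopology F; IsLocallyConstant f) ∧
    ∃ m : ℕ, ∀ g h : PGL(2, F⸨X⸩), ∀ (hg : g ∈ bddPiece F n) (hgh : g * h ∈ bddPiece F n),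
      h ∈ congruence F (m + 1) → f ⟨g * h, hgh⟩ = f ⟨g, hg⟩}
  zero_mem' := ⟨letI := loopTopology F; IsLocallyConstant.const 0, 0, fun _ _ _ _ _ => rfl⟩
  add_mem' := by
    let := loopTopology F
    rintro f f' ⟨h1, m, h2⟩ ⟨h1', m', h2'⟩
    have hmono : ∀ {a b : ℕ}, a ≤ b → congruence F (b + 1) ⊆ congruence F (a + 1) := by
      rintro a b hab _ ⟨A, hA, rfl⟩
      refine ⟨A, fun i j => ?_, rfl⟩
      obtain ⟨d, hd⟩ := hA i j
      refine ⟨PowerSeries.X ^ (b - a) * d, ?_⟩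
      rw [hd, ← mul_assoc, ← _root_.pow_add, show a + 1 + (b - a) = b + 1 by omega]
    refine ⟨h1.add h1', max m m', fun g h hg hgh hh => ?_⟩
    simp only [Pi.add_apply]
    rw [h2 g h hg hgh (hmono (le_max_left _ _) hh), h2' g h hg hgh (hmono (le_max_right _ _) hh)]
  smul_mem' := by
    let := loopTopology F
    rintro c f ⟨h1, m, h2⟩
    refine ⟨h1.comp (fun z => c • z), m, fun g h hg hgh hh => ?_⟩
    simp only [Pi.smul_apply]
    rw [h2 g h hg hgh hh]

/-- The pro-vector space `a(X^n, V) = lim_l a(X^n, V_l)`. -/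
abbrev smoothFunPro (n : ℕ) (V : ProVect.{u}) : ProVect.{u} where
  obj l := SmoothFun F n (V.obj l)
  map h :=
    { toFun := fun f => ⟨fun g => V.map h (f.1 g),
        letI := loopTopology F; f.2.1.comp (V.map h), by
          obtain ⟨m, hm⟩ := f.2.2
          exact ⟨m, fun g h hg hgh hh => congrArg _ (hm g h hg hgh hh)⟩⟩
      map_add' := fun _ _ => by ext; simp
      map_smul' := fun _ _ => by ext; simp }
  map_id i := by ext; simp [V.map_id]
  map_comp hij hjk := by ext; simp [← V.map_comp hij hjk]

variable {F}

/-- A representation of the abstract group `G(K) = PGL₂(K)` on a pro-vector space `V` is smooth if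
it comes from a representation of the group ind-pro-object `G = "colim" X^n`, i.e. from a
coaction `V ⟶ a(G, V) = lim_n a(X^n, V)`. -/
def IsSmooth (R : Action ProVect.{u} PGL(2, F⸨X⸩)) : Prop :=
  ∃ α : ∀ n : ℕ, R.V ⟶ smoothFunPro F n R.V,
    -- the evaluation of `α` at `g` is the action of `g`
    (∀ (n l : ℕ) (g : bddPiece F n),
      ProVect.Germ.post (LinearMap.proj g ∘ₗ (SmoothFun F n (R.V.obj l)).subtype)
        (ProVect.Hom.germ (α n) l) = ProVect.Hom.germ (R.ρ g.1) l) ∧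
    -- the components of `α` are compatible with the restrictions from `X^{n'}` to `X^n`
    (∀ (n n' l : ℕ) (hn : bddPiece F n ⊆ bddPiece F n'),
      ProVect.Germ.post (LinearMap.funLeft ℂ (R.V.obj l) (Set.inclusion hn) ∘ₗ
          (SmoothFun F n' (R.V.obj l)).subtype) (ProVect.Hom.germ (α n') l) =
        ProVect.Germ.post (SmoothFun F n (R.V.obj l)).subtype (ProVect.Hom.germ (α n) l)) ∧
    -- associativity, as an equality of morphisms from `V` to functions on `X^{n'} × X^n`:
    -- the action of `g g'` is the action of `g'` followed by the action of `g`
    (∀ (n n' N : ℕ) (hN : ∀ g ∈ bddPiece F n, ∀ g' ∈ bddPiece F n', g * g' ∈ bddPiece F N)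
      (l j : ℕ) (h : R.V.obj j →ₗ[ℂ] SmoothFun F n (R.V.obj l)),
      ProVect.Hom.germ (α n) l = ProVect.Germ.of j h →
      ProVect.Germ.post (LinearMap.pi fun g' : bddPiece F n' =>
          (SmoothFun F n (R.V.obj l)).subtype ∘ₗ h ∘ₗ LinearMap.proj g' ∘ₗ
            (SmoothFun F n' (R.V.obj j)).subtype) (ProVect.Hom.germ (α n') j) =
        ProVect.Germ.post (LinearMap.pi fun g' : bddPiece F n' =>
          LinearMap.funLeft ℂ (R.V.obj l)
              (fun g : bddPiece F n => (⟨g.1 * g'.1, hN g.1 g.2 g'.1 g'.2⟩ : bddPiece F N)) ∘ₗ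
            (SmoothFun F N (R.V.obj l)).subtype) (ProVect.Hom.germ (α N) l))

end LoopGroup

end

/-! An extension to `PGL(2, F⸨X⸩)` would act by a linear representation π on the projective limit of
Υ, whose vectors are families of compatible measures. Let w be the Weyl element, n(b) the unipotent
matrix with b ∈ F^*, and Λ the total mass of the N-th component with N ≥ 0. Since t^N d x has no
residue for d, x ∈ O, Λ is invariant under O^* ⋉ O. The relation w n(b) w = p w n(b⁻¹), with p ∈ O^*
⋉ O, therefore gives Λ(w n(b) w v) = Λ(w n(b⁻¹) v) (`integralComponent_weyl_unip`). Let b tend to 0.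

A morphism of pro-vector spaces sees only finitely many components at a finite level, and
conjugation by t^N moves those relevant to Λ(w ·) to indices at most -2, once N is large enough
(`integralComponent_weyl_eq_zero`). On the factor -(m+1), n(b) multiplies measures by ψ(b x_m),
which is 1 on a given compact set for small b. So the left side becomes Λ(w w v) = Λ(v).

The right side becomes 0 (`eventually_functional_mulPolar_eq_zero`): on each factor Λ(w ·) is
invariant under shifts by O^*. For m ≥ 1 the shift by 1 + r b t^m turns ψ(b⁻¹ x_m) into ψ(b⁻¹ x_m)
ψ(r x_0) and fixes a given measure, at a given level, when b is small. Since x_0 ≠ 0 on units, r can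
be chosen so that ψ(r x_0) is a constant other than 1 near a given point, and compactness of the
support finishes.

Hence Λ(v) = 0 for every v, which fails for a vector made of Haar measures of mass 1
(`exists_limEval_one_eq_one`). -/

noncomputable section

/-! ### Projective limits of pro-vector spaces -/

namespace ProVect

/-- The projective limit of a pro-vector space. -/
def lim (V : ProVect.{u}) : Submodule ℂ (∀ j, V.obj j) where
  carrier := {v | ∀ (i j : ℕ) (h : i ≤ j), V.map h (v j) = v i}
  zero_mem' := fun _ _ _ => map_zero _
  add_mem' := fun hv hw i j h => by simp [hv i j h, hw i j h]
  smul_mem' := fun c v hv i j h => by simp [hv i j h]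

/-- A morphism from `V` to a vector space, evaluated on the projective limit of `V`. -/
def Germ.eval {V : ProVect.{u}} {E : Type u} [AddCommGroup E] [Module ℂ E] :
    Germ V E →ₗ[ℂ] V.lim →ₗ[ℂ] E :=
  Module.DirectLimit.lift ℂ ℕ (fun j => V.obj j →ₗ[ℂ] E)
    (fun _ _ h => LinearMap.lcomp ℂ E (V.map h))
    (fun j => LinearMap.lcomp ℂ E (LinearMap.proj j ∘ₗ V.lim.subtype))
    (fun i j h f => by
      ext v
      exact congrArg f (v.2 i j h))

@[simp] theorem Germ.eval_of {V : ProVect.{u}} {E : Type u} [AddCommGroup E] [Module ℂ E]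
    (j : ℕ) (f : V.obj j →ₗ[ℂ] E) (v : V.lim) : Germ.eval (Germ.of j f) v = f (v.1 j) := by
  have := Module.DirectLimit.lift_of (f := fun _ _ h => LinearMap.lcomp ℂ E (V.map h))
    (fun j => LinearMap.lcomp ℂ E (LinearMap.proj j ∘ₗ V.lim.subtype))
    (fun i j h f => by
      ext v
      exact congrArg f (v.2 i j h)) f
  exact LinearMap.congr_fun this v

theorem Germ.eval_post {V : ProVect.{u}} {E E' : Type u} [AddCommGroup E] [Module ℂ E]
    [AddCommGroup E'] [Module ℂ E'] (p : E →ₗ[ℂ] E') (x : Germ V E) (v : V.lim) :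
    Germ.eval (Germ.post p x) v = p (Germ.eval x v) := by
  obtain ⟨j, f, rfl⟩ := Germ.exists_of x
  simp

/-- The linear map induced on projective limits by a morphism of pro-vector spaces. -/
def Hom.onLim {V W : ProVect.{u}} (φ : Hom V W) : V.lim →ₗ[ℂ] W.lim where
  toFun v := ⟨fun l => Germ.eval (φ.germ l) v, fun i j h => by
    rw [← Germ.eval_post, φ.compat h]⟩
  map_add' v w := Subtype.ext (funext fun l => map_add (Germ.eval (φ.germ l)) v w)
  map_smul' c v := Subtype.ext (funext fun l => map_smul (Germ.eval (φ.germ l)) c v)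

theorem Hom.onLim_apply {V W : ProVect.{u}} (φ : Hom V W) (v : V.lim) (l : ℕ) :
    (φ.onLim v).1 l = Germ.eval (φ.germ l) v := rfl

theorem Germ.eval_pre {V W : ProVect.{u}} (φ : Hom V W) {E : Type u} [AddCommGroup E]
    [Module ℂ E] (x : Germ W E) (v : V.lim) :
    Germ.eval (φ.pre E x) v = Germ.eval x (φ.onLim v) := by
  obtain ⟨j, f, rfl⟩ := Germ.exists_of x
  simp [Germ.eval_post, Hom.onLim_apply]

/-- The action of the endomorphisms of a pro-vector space on its projective limit. -/
def limEnd (V : ProVect.{u}) : End V →* Module.End ℂ V.lim where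
  toFun φ := Hom.onLim φ
  map_one' := by
    ext v l
    exact Germ.eval_of l LinearMap.id v
  map_mul' φ χ := by
    ext v l
    exact Germ.eval_pre χ (Hom.germ φ l) v

theorem limEnd_apply {V : ProVect.{u}} (φ : End V) (v : V.lim) (l : ℕ) :
    (V.limEnd φ v).1 l = Germ.eval (Hom.germ φ l) v := rfl

end ProVect

/-! ### The action of P(K) on the limit of Υ -/

section UpsilonLimit

open HahnSeries

variable {F : Type u} [Field F]

theorem PoleLE.of_natAbs_le {c : F⸨X⸩} {m : ℕ} (h : c.order.natAbs ≤ m) : PoleLE c m :=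
  PoleLE.of_order (by omega)

variable [TopologicalSpace F] [IsTopologicalRing F]

/-- The functional on locally constant functions on `O_l^*` given by an element of the projective
limit of `𝕄`. -/
def limEval (l : ℕ) : (MM F).lim →ₗ[ℂ] LCFun F l →ₗ[ℂ] ℂ where
  toFun m := (m.1 l).1
  map_add' _ _ := rfl
  map_smul' _ _ := rfl

/-- Compatibility under push-forward makes the pairing independent of the level at which a test
function is viewed. Identities between operators thus reduce to pointwise identities of functions.
-/
theorem limEval_congr (m : (MM F).lim) {i j : ℕ} {f : LCFun F i} {g : LCFun F j}
    (h : ∀ y, f.1 y = g.1 y) : limEval i m f = limEval j m g := by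
  have key : ∀ {i j : ℕ} (f : LCFun F i) (g : LCFun F j), i ≤ j → (∀ y, f.1 y = g.1 y) →
      limEval i m f = limEval j m g := by
    intro i j f g hij h
    refine (congrArg (fun D : LCMeas F i => D.1 f) (m.2 i j hij).symm).trans ?_
    exact congrArg (limEval j m) (Subtype.ext (funext h) :
      Submodule.inclusion (LCFun.mono hij) f = g)
  rcases le_total i j with hij | hij
  · exact key f g hij h
  · exact (key g f hij fun y => (h y).symm).symm

theorem eq_of_limEval_eq {m m' : (MM F).lim} {l : ℕ} (h : limEval l m = limEval l m') :
    m.1 l = m'.1 l :=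
  Subtype.ext h

theorem MM_lim_ext {m m' : (MM F).lim} (h : ∀ l f, limEval l m f = limEval l m' f) : m = m' :=
  Subtype.ext (funext fun l => eq_of_limEval_eq (LinearMap.ext (h l)))

theorem eventually_limEval_lcShift (l : ℕ) (m : (MM F).lim) :
    ∀ᶠ u in 𝓝 (1 : F⟦X⟧ˣ), ∀ f, limEval l m (lcShift u f) = limEval l m f :=
  (m.1 l).2.1

theorem exists_isCompact_limEval (l : ℕ) (m : (MM F).lim) :
    ∃ C : Set F⟦X⟧ˣ, IsCompact C ∧
      ∀ f : LCFun F l, (∀ x ∈ C, f.1 x = 0) → limEval l m f = 0 :=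
  (m.1 l).2.2

variable {ψ₀ : AddChar F ℂ} (hψ : IsLocallyConstant ψ₀)

/-- The operator `ν(u, c)` on the projective limit of `𝕄`. -/
def nuLim (u : F⟦X⟧ˣ) (c : F⸨X⸩) : (MM F).lim →ₗ[ℂ] (MM F).lim where
  toFun m := ⟨fun l => nuMap hψ u c (l := l) (m := l + c.order.natAbs) (by omega)
    (PoleLE.of_natAbs_le (by omega)) (m.1 _), fun i j h => by
      apply Subtype.ext
      apply LinearMap.ext; intro f
      exact limEval_congr m fun y => rfl⟩
  map_add' m m' := Subtype.ext (funext fun l => map_add (nuMap hψ u c _ _) _ _)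
  map_smul' r m := Subtype.ext (funext fun l => LinearMap.map_smul (nuMap hψ u c _ _) _ _)

theorem nuLim_apply (u : F⟦X⟧ˣ) (c : F⸨X⸩) (m : (MM F).lim) {l j : ℕ} (f : LCFun F l)
    (g : LCFun F j) (h : ∀ y, g.1 y = phi ψ₀ c (u⁻¹ * y) * f.1 (u⁻¹ * y)) :
    limEval l (nuLim hψ u c m) f = limEval j m g :=
  limEval_congr m fun y => (h y).symm

/-- The components in the factors `𝕄` of an element of the projective limit of `∏_{n ∈ ℤ} 𝕄`. -/
def limComponent (k : ℤ) : (MM F).prodInt.lim →ₗ[ℂ] (MM F).lim where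
  toFun v := ⟨fun l => (MM F).map (Nat.le_add_right l k.natAbs)
      (v.1 (l + k.natAbs) ⟨k, Nat.le_add_left _ _⟩), fun i j h => by
    have h1 := congrFun (v.2 (i + k.natAbs) (j + k.natAbs) (by omega)) ⟨k, by omega⟩
    exact Eq.trans rfl (congrArg ((MM F).map (Nat.le_add_right i k.natAbs)) h1)⟩
  map_add' _ _ := rfl
  map_smul' _ _ := rfl

theorem limComponent_apply (k : ℤ) (v : (MM F).prodInt.lim) {l : ℕ} (h : k.natAbs ≤ l) :
    (limComponent k v).1 l = v.1 l ⟨k, h⟩ :=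
  congrFun (v.2 l (l + k.natAbs) (by omega)) ⟨k, h⟩

/-- The element of the projective limit of `∏_{n ∈ ℤ} 𝕄` with given components. -/
def limOfComponents : (ℤ → (MM F).lim) →ₗ[ℂ] (MM F).prodInt.lim where
  toFun x := ⟨fun l n => (x n.1).1 l, fun i j h => funext fun n => (x n.1).2 i j h⟩
  map_add' _ _ := rfl
  map_smul' _ _ := rfl

theorem limComponent_limOfComponents (x : ℤ → (MM F).lim) (k : ℤ) :
    limComponent k (limOfComponents x) = x k :=
  Subtype.ext (funext fun l => (x k).2 l _ _)

theorem prodInt_lim_ext {v w : (MM F).prodInt.lim}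
    (h : ∀ k, limComponent k v = limComponent k w) : v = w := by
  refine Subtype.ext (funext fun l => funext fun n => ?_)
  exact (limComponent_apply n.1 v n.2).symm.trans
    ((congrArg (fun m => m.1 l) (h n.1)).trans (limComponent_apply n.1 w n.2))

/-- The action of `P(K)` on the projective limit of the pro-vector space `Υ`. -/
def upsilonLim : BorelPGL F⸨X⸩ →* Module.End ℂ (MM F).prodInt.lim :=
  (ProVect.limEnd (MM F).prodInt).comp (Upsilon hψ).ρ

theorem limComponent_upsilonLim (p : BorelPGL F⸨X⸩) (v : (MM F).prodInt.lim) (k : ℤ) :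
    limComponent k (upsilonLim hψ p v) =
      nuLim hψ (unitPart p.a) (single k 1 * p.b) (limComponent (k + (p.a : F⸨X⸩).order) v) := by
  refine MM_lim_ext fun l f => ?_
  -- Level `L` of the product is high enough to contain the `k`-th factor; level `j` is high enough
  -- to compute the action into level `L`.
  set L := l + k.natAbs with hL
  set j := L + (p.a : F⸨X⸩).order.natAbs + p.b.order.natAbs with hj
  have h1 : (upsilonLim hψ p v).1 L = upsilonMap hψ p L j le_rfl (v.1 j) :=
    ProVect.Germ.eval_of j (upsilonMap hψ p L j le_rfl) v
  have hpole : PoleLE (single k (1 : F) * p.b) j := PoleLE.single_mul (by omega)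
  have h2 := nuLim_apply hψ (unitPart p.a) (single k 1 * p.b)
    (limComponent (k + (p.a : F⸨X⸩).order) v) f
    (LCFun.twist hψ (unitPart p.a) (single k 1 * p.b) (by omega) hpole f) (fun y => rfl)
  rw [h2]
  have h3 := limComponent_apply (k + (p.a : F⸨X⸩).order) v (l := j) (by omega)
  have h4 := congrFun h1 ⟨k, Nat.le_add_left _ _⟩
  have h5 : limEval l (limComponent k (upsilonLim hψ p v)) f =
      ((upsilonLim hψ p v).1 L ⟨k, Nat.le_add_left _ _⟩).1
        (Submodule.inclusion (LCFun.mono (Nat.le_add_right l k.natAbs)) f) := rfl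
  rw [h5]
  refine (congrArg (fun D : LCMeas F L => D.1 _) h4).trans
    (congrArg (fun D : LCMeas F j => D.1 _) h3.symm)

end UpsilonLimit

/-! ### The units 1 + s t^{k+1} -/

section UnipotentUnits

variable {F : Type u} [Field F]

/-- The unit `1 + s t^{k+1}` of `F⟦t⟧`. -/
def oneAddUnit (k : ℕ) (s : F) : F⟦X⟧ˣ :=
  Units.mkOfMulEqOne (1 + PowerSeries.C s * PowerSeries.X ^ (k + 1))
    (PowerSeries.invOfUnit (1 + PowerSeries.C s * PowerSeries.X ^ (k + 1)) 1)
    (PowerSeries.mul_invOfUnit _ _ (by simp))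

theorem oneAddUnit_zero (k : ℕ) : oneAddUnit k (0 : F) = 1 := by
  ext1
  change (1 + PowerSeries.C (0 : F) * PowerSeries.X ^ (k + 1) : F⟦X⟧) = 1
  simp

/-- This is how a shift produces a character of the leading coefficient; it requires a coefficient
of positive index. -/
theorem coeff_oneAddUnit_mul (k : ℕ) (s : F) (y : F⟦X⟧) :
    PowerSeries.coeff (k + 1) ((oneAddUnit k s : F⟦X⟧) * y) =
      PowerSeries.coeff (k + 1) y + s * PowerSeries.coeff 0 y := by
  change PowerSeries.coeff (k + 1) ((1 + PowerSeries.C s * PowerSeries.X ^ (k + 1)) * y) = _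
  rw [add_mul, one_mul, map_add, mul_assoc, PowerSeries.coeff_C_mul,
    PowerSeries.coeff_X_pow_mul', if_pos le_rfl, Nat.sub_self]

variable [TopologicalSpace F]

theorem continuous_powerSeries_of_coeff {Y : Type*} [TopologicalSpace Y] {f : Y → F⟦X⟧}
    (h : ∀ n, Continuous fun y => PowerSeries.coeff n (f y)) : Continuous f := by
  rw [continuous_iff_continuousAt]
  intro y
  rw [ContinuousAt, PowerSeries.WithPiTopology.tendsto_iff_coeff_tendsto]
  exact fun n => (h n).continuousAt

variable [IsTopologicalRing F]

/-- Each coefficient of the inverse is a polynomial in earlier ones and in the coefficients of the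
series. The topology on units requires this control of inverses. -/
theorem continuous_invOfUnit_one {Y : Type*} [TopologicalSpace Y] {f : Y → F⟦X⟧}
    (hf : Continuous f) : Continuous fun y => PowerSeries.invOfUnit (f y) 1 := by
  refine continuous_powerSeries_of_coeff fun n => ?_
  induction n using Nat.strong_induction_on with
  | _ n ih =>
    rw [funext fun y => PowerSeries.coeff_invOfUnit n (f y) 1]
    split_ifs with hn
    · exact continuous_const
    · refine continuous_const.mul (continuous_finsetSum _ fun p _ => ?_)
      split_ifs with hp
      · exact ((PowerSeries.WithPiTopology.continuous_coeff F _).comp hf).mul (ih _ hp)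
      · exact continuous_const

theorem continuous_oneAddUnit (k : ℕ) : Continuous (oneAddUnit k : F → F⟦X⟧ˣ) := by
  have h1 : Continuous fun s : F =>
      (1 + PowerSeries.C s * PowerSeries.X ^ (k + 1) : F⟦X⟧) :=
    continuous_const.add ((PowerSeries.WithPiTopology.continuous_C (R := F)).mul continuous_const)
  exact Units.continuous_iff.2 ⟨h1, continuous_invOfUnit_one h1⟩

end UnipotentUnits

/-! ### Multiplication by ψ(b x_m) for small and for large b -/

section UnipotentLimit

open HahnSeries

variable {F : Type u} [Field F]

theorem PoleLE.mono {c : F⸨X⸩} {m n : ℕ} (h : PoleLE c m) (hmn : m ≤ n) : PoleLE c n := by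
  obtain ⟨d, rfl⟩ := h
  refine ⟨PowerSeries.X ^ (n - m) * d, ?_⟩
  rw [map_mul, HahnSeries.ofPowerSeries_X_pow, ← mul_assoc, HahnSeries.single_mul_single, mul_one]
  congr 3
  omega

/-- The Laurent series `b t^{-(m+1)}`. -/
def polarScalar (m : ℕ) (b : F) : F⸨X⸩ :=
  single (-((m : ℤ) + 1)) (1 : F) * ((PowerSeries.C b : F⟦X⟧) : F⸨X⸩)

theorem poleLE_polarScalar (m : ℕ) (b : F) : PoleLE (polarScalar m b) m := ⟨_, rfl⟩

theorem phi_polarScalar (ψ₀ : AddChar F ℂ) (m : ℕ) (b : F) (y : F⟦X⟧ˣ) :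
    phi ψ₀ (polarScalar m b) y = ψ₀ (b * PowerSeries.coeff m (y : F⟦X⟧)) := by
  rw [polarScalar, phi_eq, PowerSeries.coeff_C_mul]

variable [TopologicalSpace F] [IsTopologicalRing F]
variable {ψ₀ : AddChar F ℂ} (hψ : IsLocallyConstant ψ₀)

/-- The product of a test function with `x ↦ ψ₀ (b x_m)`. -/
def LCFun.mulPolar (m : ℕ) (b : F) {j : ℕ} (h : m ≤ j) (f : LCFun F j) : LCFun F j :=
  LCFun.twist hψ 1 (polarScalar m b) le_rfl ((poleLE_polarScalar m b).mono h) f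

theorem LCFun.mulPolar_apply (m : ℕ) (b : F) {j : ℕ} (h : m ≤ j) (f : LCFun F j) (y : F⟦X⟧ˣ) :
    (LCFun.mulPolar hψ m b h f).1 y = ψ₀ (b * PowerSeries.coeff m (y : F⟦X⟧)) * f.1 y := by
  change phi ψ₀ (polarScalar m b) (1⁻¹ * y) * f.1 (1⁻¹ * y) = _
  rw [inv_one, one_mul, phi_polarScalar]

/-- Multiplication by the function `x ↦ ψ₀ (b x_m)` on the projective limit of `𝕄`. -/
def mulPolar (m : ℕ) (b : F) : (MM F).lim →ₗ[ℂ] (MM F).lim := nuLim hψ 1 (polarScalar m b)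

theorem mulPolar_apply (m : ℕ) (b : F) (x : (MM F).lim) {l j : ℕ} (hlj : l ≤ j) (hmj : m ≤ j)
    (f : LCFun F l) :
    limEval l (mulPolar hψ m b x) f =
      limEval j x (LCFun.mulPolar hψ m b hmj (Submodule.inclusion (LCFun.mono hlj) f)) :=
  nuLim_apply hψ 1 _ x f _ fun _ => rfl

/-- At a fixed level the measure has compact support, so local constancy of ψ near 0 yields one
neighbourhood of b = 0 valid on the whole support. -/
theorem eventually_mulPolar_eq (m : ℕ) (x : (MM F).lim) (l : ℕ) :
    ∀ᶠ b in 𝓝 (0 : F), limEval l (mulPolar hψ m b x) = limEval l x := by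
  obtain ⟨C, hC, hxC⟩ := exists_isCompact_limEval (max l m) x
  have h1 : ∀ᶠ b in 𝓝 (0 : F), ∀ y ∈ C, ψ₀ (b * PowerSeries.coeff m (y : F⟦X⟧)) = 1 := by
    refine hC.eventually_forall_of_forall_eventually fun y _ => ?_
    have hcont : Continuous fun z : F × F⟦X⟧ˣ => z.1 * PowerSeries.coeff m (z.2 : F⟦X⟧) :=
      continuous_fst.mul ((PowerSeries.WithPiTopology.continuous_coeff F m).comp
        (Units.continuous_val.comp continuous_snd))
    filter_upwards [(hψ.comp_continuous hcont).eventually_eq (0, y)] with z hz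
    simpa using hz
  filter_upwards [h1] with b hb
  refine LinearMap.ext fun f => ?_
  rw [mulPolar_apply hψ m b x (le_max_left l m) (le_max_right l m) f,
    limEval_congr x (f := f) (g := Submodule.inclusion (LCFun.mono (le_max_left l m)) f) fun y => rfl,
    ← sub_eq_zero, ← map_sub]
  refine hxC _ fun y hy => ?_
  change (LCFun.mulPolar hψ m b _ _).1 y - f.1 y = 0
  rw [LCFun.mulPolar_apply, hb y hy, one_mul]
  exact sub_self _

theorem nuLim_zero_apply (u : F⟦X⟧ˣ) (x : (MM F).lim) {l : ℕ} (f : LCFun F l) :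
    limEval l (nuLim hψ u 0 x) f = limEval l x (lcShift u⁻¹ f) :=
  nuLim_apply hψ u 0 x f _ fun y => by simp [phi, lcShift]

/-- Multiplying by ψ(r x_0) is absorbed by a shift: b⁻¹ (x_{k+1} + r b x_0) = b⁻¹ x_{k+1} + r x_0,
while the measure itself does not feel the shift by 1 + r b t^{k+1}. -/
theorem limEval_mulPolar_mulPolar {k : ℕ} {r b : F} (hb0 : b ≠ 0) {x : (MM F).lim} {J L : ℕ}
    (hJL : J ≤ L) (hkL : k + 1 ≤ L)
    (hb : ∀ f, limEval L x (lcShift (oneAddUnit k (r * b)) f) = limEval L x f) :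
    limEval J (mulPolar hψ (k + 1) b⁻¹ (mulPolar hψ 0 r x)) =
      limEval J (nuLim hψ (oneAddUnit k (r * b)) 0 (mulPolar hψ (k + 1) b⁻¹ x)) := by
  refine LinearMap.ext fun f => ?_
  rw [mulPolar_apply hψ (k + 1) b⁻¹ _ hJL hkL f, mulPolar_apply hψ 0 r _ le_rfl (Nat.zero_le L),
    nuLim_zero_apply, mulPolar_apply hψ (k + 1) b⁻¹ _ hJL hkL, ← hb (LCFun.mulPolar _ _ _ hkL _)]
  refine congrArg (limEval L x) (Subtype.ext (funext fun y => ?_))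
  have h1 : b⁻¹ * PowerSeries.coeff (k + 1) ((oneAddUnit k (r * b) * y : F⟦X⟧ˣ) : F⟦X⟧) =
      r * PowerSeries.coeff 0 (y : F⟦X⟧) + b⁻¹ * PowerSeries.coeff (k + 1) (y : F⟦X⟧) := by
    rw [Units.val_mul, coeff_oneAddUnit_mul]
    field_simp
    ring
  have h2 : (LCFun.mulPolar hψ (k + 1) b⁻¹ hkL
      (Submodule.inclusion (LCFun.mono hJL) (lcShift (oneAddUnit k (r * b))⁻¹ f))).1
        (oneAddUnit k (r * b) * y) =
      ψ₀ (b⁻¹ * PowerSeries.coeff (k + 1) ((oneAddUnit k (r * b) * y : F⟦X⟧ˣ) : F⟦X⟧)) *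
        f.1 ((oneAddUnit k (r * b))⁻¹ * (oneAddUnit k (r * b) * y)) :=
    LCFun.mulPolar_apply hψ _ _ _ _ _
  have h3 : (LCFun.mulPolar hψ (k + 1) b⁻¹ hkL
      (Submodule.inclusion (LCFun.mono hJL) f)).1 y =
      ψ₀ (b⁻¹ * PowerSeries.coeff (k + 1) (y : F⟦X⟧)) * f.1 y :=
    LCFun.mulPolar_apply hψ _ _ _ _ _
  refine (LCFun.mulPolar_apply hψ _ _ _ _ _).trans (Eq.trans ?_ h2.symm)
  rw [inv_mul_cancel_left, h1, AddChar.map_add_eq_mul, mul_assoc]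
  exact congrArg _ h3

theorem eventually_functional_mulPolar_mulPolar {Λ : (MM F).lim →ₗ[ℂ] ℂ} {J : ℕ}
    (hJ : ∀ x : (MM F).lim, limEval J x = 0 → Λ x = 0)
    (hinv : ∀ (u : F⟦X⟧ˣ) (x : (MM F).lim), Λ (nuLim hψ u 0 x) = Λ x)
    (k : ℕ) (r : F) (x : (MM F).lim) :
    ∀ᶠ b in 𝓝[≠] (0 : F), Λ (mulPolar hψ (k + 1) b⁻¹ (mulPolar hψ 0 r x)) =
      Λ (mulPolar hψ (k + 1) b⁻¹ x) := by
  have hcont : Continuous fun b : F => oneAddUnit k (r * b) :=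
    (continuous_oneAddUnit k).comp (continuous_const_mul r)
  have ht : Filter.Tendsto (fun b : F => oneAddUnit k (r * b)) (𝓝[≠] 0) (𝓝 1) := by
    have := hcont.tendsto 0
    rw [mul_zero, oneAddUnit_zero] at this
    exact this.mono_left nhdsWithin_le_nhds
  filter_upwards [ht.eventually (eventually_limEval_lcShift (max J (k + 1)) x),
    self_mem_nhdsWithin] with b hb hb0
  rw [← hinv (oneAddUnit k (r * b)) (mulPolar hψ (k + 1) b⁻¹ x), ← sub_eq_zero, ← map_sub]
  refine hJ _ ?_
  rw [map_sub, sub_eq_zero]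
  exact limEval_mulPolar_mulPolar hψ hb0 (le_max_left _ _) (le_max_right _ _) hb

/-- By the preceding lemma, multiplying x by ψ(r x_0) - ψ(z) multiplies the quantity in question by
1 - ψ(z) for small b, a nonzero constant if ψ(z) ≠ 1. Finitely many such factors annihilate x at the
relevant level, one for each piece of a cover of its compact support. -/
theorem eventually_functional_mulPolar_eq_zero {Λ : (MM F).lim →ₗ[ℂ] ℂ} {J : ℕ}
    (hJ : ∀ x : (MM F).lim, limEval J x = 0 → Λ x = 0)
    (hinv : ∀ (u : F⟦X⟧ˣ) (x : (MM F).lim), Λ (nuLim hψ u 0 x) = Λ x)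
    (hψ1 : ∃ z, ψ₀ z ≠ 1) (k : ℕ) (x : (MM F).lim) :
    ∀ᶠ b in 𝓝[≠] (0 : F), Λ (mulPolar hψ (k + 1) b⁻¹ x) = 0 := by
  set L := max J (k + 1) with hL
  have hJL : J ≤ L := le_max_left _ _
  have hkL : k + 1 ≤ L := le_max_right _ _
  let Q : (MM F).lim → Prop := fun x => ∀ᶠ b in 𝓝[≠] (0 : F), Λ (mulPolar hψ (k + 1) b⁻¹ x) = 0
  let Supp : (MM F).lim → Set F⟦X⟧ˣ → Prop := fun x T =>
    ∀ f : LCFun F L, (∀ y ∈ T, f.1 y = 0) → limEval L x f = 0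
  have hmono : ∀ x S T, S ⊆ T → Supp x S → Supp x T :=
    fun x S T hST hx f hf => hx f fun y hy => hf y (hST hy)
  obtain ⟨C, hC, hxC⟩ := exists_isCompact_limEval L x
  -- Compact induction: `A` is a composite of these multiplications, removing the given set from the
  -- support while the conclusion for `A x` still implies it for `x`.
  have key : ∃ A : (MM F).lim → (MM F).lim, (∀ x, Q (A x) → Q x) ∧
      ∀ x T, Supp x T → Supp (A x) (T \ C) := by
    refine hC.induction_on (p := fun s => ∃ A : (MM F).lim → (MM F).lim, (∀ x, Q (A x) → Q x) ∧
      ∀ x T, Supp x T → Supp (A x) (T \ s)) ⟨id, fun _ h => h, fun x T h => by simpa using h⟩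
      ?_ ?_ ?_
    · rintro s t hst ⟨A, hA, hA'⟩
      exact ⟨A, hA, fun x T h => hmono _ _ _ (Set.sdiff_subset_sdiff_right hst) (hA' x T h)⟩
    · rintro s t ⟨A, hA, hA'⟩ ⟨B, hB, hB'⟩
      refine ⟨fun x => B (A x), fun x h => hA x (hB _ h), fun x T h => ?_⟩
      rw [← Set.sdiff_sdiff]
      exact hB' _ _ (hA' _ _ h)
    · intro y _
      have hy0 : PowerSeries.coeff 0 (y : F⟦X⟧) ≠ 0 := by
        rw [PowerSeries.coeff_zero_eq_constantCoeff_apply]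
        exact (PowerSeries.isUnit_iff_constantCoeff.1 y.isUnit).ne_zero
      obtain ⟨z, hz⟩ := hψ1
      -- With this `r`, the function ψ(r x_0) equals ψ(z) on a neighbourhood of `y`, so ψ(r x_0) -
      -- ψ(z) vanishes there.
      set r := z / PowerSeries.coeff 0 (y : F⟦X⟧) with hr
      have hry : r * PowerSeries.coeff 0 (y : F⟦X⟧) = z := div_mul_cancel₀ _ hy0
      refine ⟨{y' | ψ₀ (r * PowerSeries.coeff 0 (y' : F⟦X⟧)) = ψ₀ z}, mem_nhdsWithin_of_mem_nhds ?_,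
        fun x => mulPolar hψ 0 r x - ψ₀ z • x, fun x hx => ?_, fun x T hx f hf => ?_⟩
      · have hcont : Continuous fun y' : F⟦X⟧ˣ => r * PowerSeries.coeff 0 (y' : F⟦X⟧) :=
          continuous_const.mul ((PowerSeries.WithPiTopology.continuous_coeff F 0).comp
            Units.continuous_val)
        filter_upwards [(hψ.comp_continuous hcont).eventually_eq y] with y' hy'
        exact hy'.trans (congrArg ψ₀ hry)
      · filter_upwards [hx, eventually_functional_mulPolar_mulPolar hψ hJ hinv k r x] with b h1 h2
        rw [map_sub, map_sub, map_smul, map_smul, h2, smul_eq_mul, ← one_sub_mul] at h1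
        exact (mul_eq_zero.1 h1).resolve_left (sub_ne_zero.2 (Ne.symm hz))
      · rw [map_sub, map_smul, LinearMap.sub_apply, LinearMap.smul_apply,
          mulPolar_apply hψ 0 r x le_rfl (Nat.zero_le L), ← map_smul, ← map_sub]
        refine hx _ fun y' hy' => ?_
        change (LCFun.mulPolar hψ 0 r _ _).1 y' - ψ₀ z * f.1 y' = 0
        rw [LCFun.mulPolar_apply]
        change _ * f.1 y' - _ = 0
        by_cases h : ψ₀ (r * PowerSeries.coeff 0 (y' : F⟦X⟧)) = ψ₀ z
        · rw [h, sub_self]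
        · rw [hf y' ⟨hy', h⟩, mul_zero, mul_zero, sub_self]
  obtain ⟨A, hA, hA'⟩ := key
  -- The support of `A x` at level `L` lies in `C \ C`, hence is empty, and the claim for `A x`
  -- holds for every `b`.
  refine hA x (Filter.Eventually.of_forall fun b => hJ _ (LinearMap.ext fun f => ?_))
  rw [mulPolar_apply hψ (k + 1) b⁻¹ _ hJL hkL]
  exact hA' x C hxC _ fun y hy => absurd hy.1 hy.2

end UnipotentLimit

/-! ### A compatible family of measures of total mass 1 -/

section HaarMeasure

/-- The constant function `1`. -/
def LCFun.one (F : Type u) [Field F] [TopologicalSpace F] (n : ℕ) : LCFun F n :=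
  ⟨fun _ => 1, IsLocallyConstant.const 1, fun _ _ _ => rfl⟩

variable {F : Type u} [Field F] [ValuativeRel F] [TopologicalSpace F]

/-- The inclusion of the units of `O_F⟦t⟧` into the units of `F⟦t⟧`. -/
def integralUnits (F : Type u) [Field F] [ValuativeRel F] : 𝒪[F]⟦X⟧ˣ →* F⟦X⟧ˣ :=
  Units.map (PowerSeries.map (algebraMap 𝒪[F] F) : 𝒪[F]⟦X⟧ →* F⟦X⟧)

theorem continuous_integralUnits : Continuous (integralUnits F) := by
  refine Continuous.units_map _ (continuous_powerSeries_of_coeff fun n => ?_)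
  exact continuous_subtype_val.comp (PowerSeries.WithPiTopology.continuous_coeff 𝒪[F] n)

variable [IsNonarchimedeanLocalField F]

theorem IsNonarchimedeanLocalField.t2Space : T2Space F := by
  let := IsTopologicalAddGroup.rightUniformSpace F
  have := isUniformAddGroup_of_addCommGroup (G := F)
  infer_instance

/-- Nontriviality of the valuation gives nonzero elements of arbitrarily small value. It ensures
that the final limit b → 0 has nonzero b to pick. -/
theorem IsNonarchimedeanLocalField.nhdsNE_zero_neBot : (𝓝[≠] (0 : F)).NeBot := by
  rw [← mem_closure_iff_nhdsWithin_neBot,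
    mem_closure_iff_nhds_basis (IsValuativeTopology.hasBasis_nhds_zero' F)]
  intro γ hγ
  obtain ⟨δ, hδ, hδ1⟩ := ValuativeRel.IsNontrivial.exists_lt_one (R := F)
  obtain ⟨x, hx⟩ := ValuativeRel.valuation_surjective (γ * δ)
  refine ⟨x, fun h => ?_, ?_⟩
  · rw [Set.mem_singleton_iff.1 h, map_zero] at hx
    exact mul_ne_zero hγ hδ.ne' hx.symm
  · change ValuativeRel.valuation F x < γ
    rw [hx]
    exact mul_lt_of_lt_one_right (zero_lt_iff.2 hγ) hδ1

instance compactSpace_powerSeries_integers : CompactSpace 𝒪[F]⟦X⟧ :=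
  inferInstanceAs (CompactSpace ((Unit →₀ ℕ) → 𝒪[F]))

/-- A neighbourhood of 1 restricts only finitely many coefficients, so a nearby unit is integral
only modulo t^{l+1}. That suffices for level `l`: test functions ignore the rest, so invariance
under integral units gives invariance near 1. -/
theorem exists_integralUnits_congr (l : ℕ) : ∀ᶠ u : F⟦X⟧ˣ in 𝓝 1, ∃ u' : 𝒪[F]⟦X⟧ˣ,
    PowerSeries.X ^ (l + 1) ∣ (((integralUnits F u')⁻¹ * u : F⟦X⟧ˣ) : F⟦X⟧) - 1 := by
  have h0 : ∀ᶠ z in 𝓝 (0 : F), ValuativeRel.valuation F z < 1 :=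
    (IsValuativeTopology.hasBasis_nhds_zero' F).mem_of_mem (i := 1) one_ne_zero
  have h1 : ∀ n, ∀ᶠ u : F⟦X⟧ˣ in 𝓝 1,
      ValuativeRel.valuation F (PowerSeries.coeff n ((u : F⟦X⟧) - 1)) < 1 := by
    intro n
    have hcont : Continuous fun u : F⟦X⟧ˣ => PowerSeries.coeff n ((u : F⟦X⟧) - 1) :=
      (PowerSeries.WithPiTopology.continuous_coeff F n).comp
        (Units.continuous_val.sub continuous_const)
    have := hcont.tendsto 1
    rw [Units.val_one, sub_self, map_zero] at this
    exact this.eventually h0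
  have h2 : ∀ᶠ u : F⟦X⟧ˣ in 𝓝 1, ∀ n ∈ Finset.range (l + 1),
      ValuativeRel.valuation F (PowerSeries.coeff n ((u : F⟦X⟧) - 1)) < 1 :=
    (Filter.eventually_all_finset _).2 fun n _ => h1 n
  filter_upwards [h2] with u hu
  let e : 𝒪[F]⟦X⟧ := PowerSeries.mk fun n => if h : n ∈ Finset.range (l + 1) then
    ⟨PowerSeries.coeff n ((u : F⟦X⟧) - 1), (hu n h).le⟩ else 0
  -- The constant coefficient of `e` lies in the maximal ideal of the local ring `𝒪[F]`.
  have hunit : IsUnit (1 + e) := by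
    rw [PowerSeries.isUnit_iff_constantCoeff, map_add, map_one]
    have h3 : PowerSeries.constantCoeff e ∈ IsLocalRing.maximalIdeal 𝒪[F] := by
      rw [← PowerSeries.coeff_zero_eq_constantCoeff_apply, PowerSeries.coeff_mk,
        dif_pos (by simp)]
      exact (IsLocalRing.mem_maximalIdeal _).2 fun h => (hu 0 (by simp)).ne
        ((Valuation.integer.integers (ValuativeRel.valuation F)).isUnit_iff_valuation_eq_one.1 h)
    by_contra h4
    have h5 := (IsLocalRing.maximalIdeal 𝒪[F]).sub_mem ((IsLocalRing.mem_maximalIdeal _).2 h4) h3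
    rw [add_sub_cancel_right] at h5
    exact (IsLocalRing.mem_maximalIdeal _).1 h5 isUnit_one
  refine ⟨hunit.unit, ?_⟩
  set v := integralUnits F hunit.unit with hv
  have h4 : PowerSeries.X ^ (l + 1) ∣ (u : F⟦X⟧) - (v : F⟦X⟧) := by
    rw [PowerSeries.X_pow_dvd_iff]
    intro n hn
    have h5 : (v : F⟦X⟧) = 1 + PowerSeries.map (algebraMap 𝒪[F] F) e := by
      change PowerSeries.map (algebraMap 𝒪[F] F) (1 + e) = _
      rw [map_add, map_one]
    rw [h5, ← sub_sub, map_sub, PowerSeries.coeff_map, PowerSeries.coeff_mk,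
      dif_pos (Finset.mem_range.2 hn)]
    exact sub_self _
  have h6 : ((v⁻¹ * u : F⟦X⟧ˣ) : F⟦X⟧) - 1 = ((v⁻¹ : F⟦X⟧ˣ) : F⟦X⟧) * ((u : F⟦X⟧) - v) := by
    rw [mul_sub, Units.inv_mul, Units.val_mul]
  rw [h6]
  exact h4.mul_left _

open MeasureTheory in
/-- The push-forward of the Haar measure of `O_F⟦t⟧ˣ` has total mass `1`. -/
theorem exists_limEval_one_eq_one : ∃ m : (MM F).lim, limEval 0 m (LCFun.one F 0) = 1 := by
  let : MeasurableSpace 𝒪[F]⟦X⟧ˣ := borel _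
  have : BorelSpace 𝒪[F]⟦X⟧ˣ := ⟨rfl⟩
  have : T2Space F := IsNonarchimedeanLocalField.t2Space
  let μ : Measure 𝒪[F]⟦X⟧ˣ := Measure.haarMeasure ⊤
  have hμ : μ Set.univ = 1 := Measure.haarMeasure_self
  have : IsProbabilityMeasure μ := ⟨hμ⟩
  have hint : ∀ {l : ℕ} (f : LCFun F l), Integrable (fun x => f.1 (integralUnits F x)) μ :=
    fun f => (f.2.1.continuous.comp continuous_integralUnits).integrable_of_hasCompactSupport
      (HasCompactSupport.of_compactSpace _)
  let D : ∀ l, LCFun F l →ₗ[ℂ] ℂ := fun l =>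
    { toFun := fun f => ∫ x, f.1 (integralUnits F x) ∂μ
      map_add' := fun f g => integral_add (hint f) (hint g)
      map_smul' := fun c f => integral_const_mul c _ }
  have hD : ∀ l, D l ∈ LCMeas F l := by
    intro l
    refine ⟨?_, Set.range (integralUnits F), isCompact_range continuous_integralUnits,
      fun f hf => ?_⟩
    · filter_upwards [exists_integralUnits_congr (F := F) l] with u hu f
      obtain ⟨u', hu'⟩ := hu
      change ∫ x, f.1 (u * integralUnits F x) ∂μ = ∫ x, f.1 (integralUnits F x) ∂μ
      rw [← integral_mul_left_eq_self (fun x => f.1 (integralUnits F x)) u']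
      refine integral_congr_ae (Filter.Eventually.of_forall fun x => ?_)
      change f.1 (u * integralUnits F x) = f.1 (integralUnits F (u' * x))
      rw [← f.2.2 (integralUnits F (u' * x)) _ hu', map_mul]
      rw [mul_right_comm, mul_inv_cancel_left]
    · change ∫ x, f.1 (integralUnits F x) ∂μ = 0
      simp [hf]
  refine ⟨⟨fun l => ⟨D l, hD l⟩, fun _ _ _ => rfl⟩, ?_⟩
  change ∫ x, (1 : ℂ) ∂μ = 1
  simp

end HaarMeasure

/-! ### Relations between the Weyl element and P(K) -/

section Bruhat

open Matrix

variable (K : Type u) [Field K]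

/-- The class in `PGL₂(K)` of the matrix `(0 1; 1 0)`. -/
def weylPGL : PGL(2, K) :=
  ProjGenLinGroup.mk (GeneralLinearGroup.mkOfDetNeZero !![0, 1; 1, 0] (by simp))

variable {K}

theorem weylPGL_mul_self : weylPGL K * weylPGL K = 1 := by
  rw [weylPGL, ← map_mul, ← map_one ProjGenLinGroup.mk]
  congr 1
  ext i j
  fin_cases i <;> fin_cases j <;>
    simp [GeneralLinearGroup.mkOfDetNeZero, Matrix.mul_apply, Fin.sum_univ_two]

theorem toPGL_mul_weylPGL (a : Kˣ) :
    BorelPGL.toPGL ⟨a, 0⟩ * weylPGL K = weylPGL K * BorelPGL.toPGL ⟨a⁻¹, 0⟩ := by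
  rw [weylPGL, BorelPGL.toPGL, MonoidHom.comp_apply, MonoidHom.comp_apply, ← map_mul, ← map_mul]
  refine (ProjGenLinGroup.mk_eq_mk_iff.2 ⟨a, ?_⟩).symm
  ext i j
  fin_cases i <;> fin_cases j <;>
    simp [GeneralLinearGroup.mkOfDetNeZero, BorelPGL.toGL, Matrix.mul_apply, Fin.sum_univ_two]

/-- This is the Bruhat decomposition of the lower unipotent matrix with entry b; the two sides agree
in `GL₂` up to the scalar b. -/
theorem weylPGL_mul_toPGL_mul_weylPGL (b : Kˣ) :
    weylPGL K * BorelPGL.toPGL ⟨1, (b : K)⟩ * weylPGL K =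
      BorelPGL.toPGL ⟨-(b⁻¹ * b⁻¹), ((b⁻¹ : Kˣ) : K)⟩ * weylPGL K *
        BorelPGL.toPGL ⟨1, ((b⁻¹ : Kˣ) : K)⟩ := by
  rw [weylPGL, BorelPGL.toPGL, MonoidHom.comp_apply, MonoidHom.comp_apply, MonoidHom.comp_apply,
    ← map_mul, ← map_mul, ← map_mul, ← map_mul]
  refine (ProjGenLinGroup.mk_eq_mk_iff.2 ⟨b, ?_⟩).symm
  ext i j
  fin_cases i <;> fin_cases j <;>
    simp [GeneralLinearGroup.mkOfDetNeZero, BorelPGL.toGL, Matrix.mul_apply, Fin.sum_univ_two]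

end Bruhat

/-! ### Consequences of an extension to PGL₂ -/

section Extension

open HahnSeries

variable {F : Type u} [Field F]

theorem coeff_powerSeries_of_neg (d : F⟦X⟧) {n : ℤ} (hn : n < 0) : (d : F⸨X⸩).coeff n = 0 := by
  rw [PowerSeries.coeff_coe, if_pos hn]

/-- A unit of `F⟦t⟧` as a unit of `F⸨t⸩`. -/
def laurentUnit : F⟦X⟧ˣ →* F⸨X⸩ˣ := Units.map (HahnSeries.ofPowerSeries ℤ F : F⟦X⟧ →* F⸨X⸩)

theorem coe_laurentUnit (u : F⟦X⟧ˣ) : (laurentUnit u : F⸨X⸩) = ((u : F⟦X⟧) : F⸨X⸩) := rfl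

/-- The orders of u and u⁻¹ are both nonnegative and add up to 0. -/
theorem order_laurentUnit (u : F⟦X⟧ˣ) : (laurentUnit u : F⸨X⸩).order = 0 := by
  have h : ∀ u : F⟦X⟧ˣ, 0 ≤ (laurentUnit u : F⸨X⸩).order := by
    intro u
    by_contra h
    exact HahnSeries.coeff_order_eq_zero.not.2 (laurentUnit u).ne_zero
      (coeff_powerSeries_of_neg (u : F⟦X⟧) (not_le.1 h))
  have h1 := order_units_mul (laurentUnit u) (laurentUnit u⁻¹)
  rw [← map_mul, mul_inv_cancel, map_one, Units.val_one, HahnSeries.order_one] at h1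
  have h2 := h u
  have h3 := h u⁻¹
  omega

theorem unitPart_laurentUnit (u : F⟦X⟧ˣ) : unitPart (laurentUnit u) = u := by
  ext1
  apply HahnSeries.ofPowerSeries_injective (Γ := ℤ) (R := F)
  rw [coe_unitPart, order_laurentUnit, neg_zero, coe_laurentUnit]
  exact one_mul _

/-- The power `t^n`, as a unit of `F⸨t⸩`. -/
def uniformizerPow (F : Type u) [Field F] (n : ℤ) : F⸨X⸩ˣ :=
  Units.mk0 (single n (1 : F)) (by simp)

theorem order_uniformizerPow (n : ℤ) : (uniformizerPow F n : F⸨X⸩).order = n :=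
  HahnSeries.order_single one_ne_zero

theorem order_uniformizerPow_inv (n : ℤ) :
    (((uniformizerPow F n)⁻¹ : F⸨X⸩ˣ) : F⸨X⸩).order = -n := by
  have h1 := order_units_mul (uniformizerPow F n) (uniformizerPow F n)⁻¹
  rw [mul_inv_cancel, Units.val_one, HahnSeries.order_one, order_uniformizerPow] at h1
  omega

variable [TopologicalSpace F] [IsTopologicalRing F]
variable {ψ₀ : AddChar F ℂ} (hψ : IsLocallyConstant ψ₀)

theorem limComponent_upsilonLim_diag (a : F⸨X⸩ˣ) (v : (MM F).prodInt.lim) (k : ℤ) :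
    limComponent k (upsilonLim hψ ⟨a, 0⟩ v) =
      nuLim hψ (unitPart a) 0 (limComponent (k + (a : F⸨X⸩).order) v) := by
  rw [limComponent_upsilonLim, mul_zero]

theorem limComponent_upsilonLim_unip (b : F) (v : (MM F).prodInt.lim) (m : ℕ) :
    limComponent (-((m : ℤ) + 1))
        (upsilonLim hψ ⟨1, ((PowerSeries.C b : F⟦X⟧) : F⸨X⸩)⟩ v) =
      mulPolar hψ m b (limComponent (-((m : ℤ) + 1)) v) := by
  rw [limComponent_upsilonLim, unitPart_one, Units.val_one, HahnSeries.order_one, add_zero]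
  rfl

/-- The functional on the projective limit of `Υ` which integrates the `n`-th component. -/
def integralComponent (F : Type u) [Field F] [TopologicalSpace F] [IsTopologicalRing F] (n : ℤ) :
    (MM F).prodInt.lim →ₗ[ℂ] ℂ :=
  LinearMap.applyₗ (LCFun.one F 0) ∘ₗ limEval 0 ∘ₗ limComponent n

theorem integralComponent_apply (n : ℤ) (v : (MM F).prodInt.lim) :
    integralComponent F n v = limEval 0 (limComponent n v) (LCFun.one F 0) := rfl

/-- For n ≥ 0 the series t^n d y is integral, so its residue vanishes and the multiplier is 1;
shifts preserve total mass. -/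
theorem integralComponent_upsilonLim (n : ℕ) (u : F⟦X⟧ˣ) (d : F⟦X⟧) (v : (MM F).prodInt.lim) :
    integralComponent F n (upsilonLim hψ ⟨laurentUnit u, (d : F⸨X⸩)⟩ v) =
      integralComponent F n v := by
  rw [integralComponent_apply, limComponent_upsilonLim, order_laurentUnit, add_zero]
  refine nuLim_apply hψ _ _ _ _ _ fun y => ?_
  have h : single (n : ℤ) (1 : F) = ((PowerSeries.X ^ n : F⟦X⟧) : F⸨X⸩) :=
    (HahnSeries.ofPowerSeries_X_pow n).symm
  rw [phi, h, ← map_mul, ← map_mul, coeff_powerSeries_of_neg _ (by norm_num),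
    AddChar.map_zero_eq_one]
  exact (one_mul 1).symm

theorem integralComponent_zero_diag (n : ℤ) (v : (MM F).prodInt.lim) :
    integralComponent F 0 (upsilonLim hψ ⟨uniformizerPow F n, 0⟩ v) =
      integralComponent F n v := by
  rw [integralComponent_apply, limComponent_upsilonLim_diag, order_uniformizerPow, zero_add]
  exact nuLim_apply hψ _ _ _ _ _ fun y => by simp [phi, LCFun.one]

/-- The inclusion of the `k`-th factor into the projective limit of `∏_{n ∈ ℤ} 𝕄`. -/
def limSingle (k : ℤ) : (MM F).lim →ₗ[ℂ] (MM F).prodInt.lim :=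
  limOfComponents ∘ₗ LinearMap.single ℂ (fun _ => (MM F).lim) k

theorem limComponent_limSingle (k n : ℤ) (x : (MM F).lim) :
    limComponent n (limSingle k x) = Pi.single (M := fun _ => (MM F).lim) k x n :=
  limComponent_limOfComponents _ _

theorem upsilonLim_limSingle (u : F⟦X⟧ˣ) (k : ℤ) (x : (MM F).lim) :
    upsilonLim hψ ⟨laurentUnit u, 0⟩ (limSingle k x) = limSingle k (nuLim hψ u 0 x) := by
  refine prodInt_lim_ext fun n => ?_
  rw [limComponent_upsilonLim_diag, order_laurentUnit, add_zero, unitPart_laurentUnit,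
    limComponent_limSingle, limComponent_limSingle]
  by_cases h : n = k
  · subst h
    rw [Pi.single_eq_same, Pi.single_eq_same]
  · rw [Pi.single_eq_of_ne h, Pi.single_eq_of_ne h, map_zero]

variable {π : PGL(2, F⸨X⸩) →* Module.End ℂ (MM F).prodInt.lim}

/-- Component J + 2 is component 0 after acting by t^{J+2}, which passes through w as t^{-(J+2)}.
The window |k| ≤ J seen by component 0 is thereby translated to [-(2J+2), -2]. The offset J + 2
makes every index at most -2, so that n(b) acts there through a coefficient x_m with m ≥ 1. -/
theorem integralComponent_weyl_eq_zero (hπ : ∀ p, π (BorelPGL.toPGL p) = upsilonLim hψ p) {J : ℕ}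
    (hJ : ∀ v : (MM F).prodInt.lim, v.1 J = 0 → (π (weylPGL _) v).1 0 = 0)
    {v : (MM F).prodInt.lim}
    (hv : ∀ k ∈ Finset.Icc (-(2 * J + 2) : ℤ) (-2), limEval J (limComponent k v) = 0) :
    integralComponent F (J + 2 : ℕ) (π (weylPGL _) v) = 0 := by
  rw [← integralComponent_zero_diag hψ, ← hπ, ← Module.End.mul_apply, ← map_mul,
    toPGL_mul_weylPGL, map_mul, Module.End.mul_apply, hπ]
  set w := upsilonLim hψ ⟨(uniformizerPow F (J + 2 : ℕ))⁻¹, 0⟩ v with hw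
  have hwJ : w.1 J = 0 := by
    refine funext fun n => ?_
    have h1 : limEval J (limComponent n.1 w) = limEval J 0 := by
      rw [hw, limComponent_upsilonLim_diag, order_uniformizerPow_inv]
      refine LinearMap.ext fun f => ?_
      rw [nuLim_zero_apply, hv _ (by
        have := n.2
        rw [Finset.mem_Icc]
        push_cast
        omega), map_zero]
      rfl
    exact (limComponent_apply n.1 w n.2).symm.trans (eq_of_limEval_eq h1)
  have h2 : (limComponent 0 (π (weylPGL _) w)).1 0 = 0 :=
    (limComponent_apply 0 (π (weylPGL _) w) (l := 0) (by simp)).trans (congrFun (hJ w hwJ) _)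
  exact congrArg (fun D : LCMeas F 0 => D.1 (LCFun.one F 0)) h2

theorem integralComponent_weyl_eq_sum (hπ : ∀ p, π (BorelPGL.toPGL p) = upsilonLim hψ p) {J : ℕ}
    (hJ : ∀ v : (MM F).prodInt.lim, v.1 J = 0 → (π (weylPGL _) v).1 0 = 0)
    (v : (MM F).prodInt.lim) :
    integralComponent F (J + 2 : ℕ) (π (weylPGL _) v) =
      ∑ k ∈ Finset.Icc (-(2 * J + 2) : ℤ) (-2),
        integralComponent F (J + 2 : ℕ) (π (weylPGL _) (limSingle k (limComponent k v))) := by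
  rw [← map_sum, ← map_sum, ← sub_eq_zero, ← map_sub, ← map_sub]
  refine integralComponent_weyl_eq_zero hψ hπ hJ fun k hk => ?_
  rw [map_sub, map_sum, Finset.sum_eq_single k, limComponent_limSingle, Pi.single_eq_same,
    sub_self, map_zero]
  · intro n _ hn
    rw [limComponent_limSingle, Pi.single_eq_of_ne hn.symm]
  · exact fun h => absurd hk h

/-- In the Bruhat relation the left factor has diagonal entry -b⁻² ∈ O^* and upper entry b⁻¹ ∈ O, so
the functional absorbs it. -/
theorem integralComponent_weyl_unip (hπ : ∀ p, π (BorelPGL.toPGL p) = upsilonLim hψ p) (n : ℕ)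
    {b : F} (hb : b ≠ 0) (v : (MM F).prodInt.lim) :
    integralComponent F n (π (weylPGL _)
        (upsilonLim hψ ⟨1, ((PowerSeries.C b : F⟦X⟧) : F⸨X⸩)⟩ (π (weylPGL _) v))) =
      integralComponent F n (π (weylPGL _)
        (upsilonLim hψ ⟨1, ((PowerSeries.C b⁻¹ : F⟦X⟧) : F⸨X⸩)⟩ v)) := by
  let c : F⟦X⟧ˣ := Units.map (PowerSeries.C : F →+* F⟦X⟧) (Units.mk0 b hb)
  have hc : ((laurentUnit c)⁻¹ : F⸨X⸩ˣ) = laurentUnit c⁻¹ := (map_inv laurentUnit c).symm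
  have h := congrArg (fun g => integralComponent F n (π g v))
    (weylPGL_mul_toPGL_mul_weylPGL (laurentUnit c))
  have hcinv : ((c⁻¹ : F⟦X⟧ˣ) : F⟦X⟧) = PowerSeries.C b⁻¹ := by
    change PowerSeries.C (((Units.mk0 b hb)⁻¹ : Fˣ) : F) = _
    rw [Units.val_inv_eq_inv_val, Units.val_mk0]
  have hneg : -((laurentUnit c)⁻¹ * (laurentUnit c)⁻¹) = laurentUnit (-(c⁻¹ * c⁻¹)) := by
    rw [hc, ← map_mul]
    ext1
    rw [Units.val_neg, coe_laurentUnit, coe_laurentUnit, Units.val_neg, map_neg]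
  simp only [map_mul, Module.End.mul_apply, hπ] at h
  rw [hneg] at h
  simp only [hc, coe_laurentUnit] at h
  rw [integralComponent_upsilonLim, hcinv] at h
  exact h

/-- A diagonal unit passes through w as its inverse, and total mass is invariant under it. This
supplies the shift invariance required by `eventually_functional_mulPolar_eq_zero`. -/
theorem integralComponent_weyl_limSingle (hπ : ∀ p, π (BorelPGL.toPGL p) = upsilonLim hψ p)
    (n : ℕ) (k : ℤ) (u : F⟦X⟧ˣ) (x : (MM F).lim) :
    integralComponent F n (π (weylPGL _) (limSingle k (nuLim hψ u 0 x))) =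
      integralComponent F n (π (weylPGL _) (limSingle k x)) := by
  rw [← upsilonLim_limSingle, ← hπ, ← Module.End.mul_apply, ← map_mul]
  have h := toPGL_mul_weylPGL (laurentUnit u⁻¹)
  rw [← map_inv, inv_inv] at h
  rw [← h, map_mul, Module.End.mul_apply, hπ]
  have := integralComponent_upsilonLim hψ n u⁻¹ 0 (π (weylPGL _) (limSingle k x))
  rwa [map_zero] at this

theorem eventually_integralComponent_weyl_unip
    (hπ : ∀ p, π (BorelPGL.toPGL p) = upsilonLim hψ p) {J : ℕ}
    (hJ : ∀ v : (MM F).prodInt.lim, v.1 J = 0 → (π (weylPGL _) v).1 0 = 0)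
    (v : (MM F).prodInt.lim) : ∀ᶠ b in 𝓝 (0 : F),
      integralComponent F (J + 2 : ℕ) (π (weylPGL _)
        (upsilonLim hψ ⟨1, ((PowerSeries.C b : F⟦X⟧) : F⸨X⸩)⟩ v)) =
      integralComponent F (J + 2 : ℕ) (π (weylPGL _) v) := by
  have h1 : ∀ᶠ b in 𝓝 (0 : F), ∀ k ∈ Finset.Icc (-(2 * J + 2) : ℤ) (-2),
      limEval J (mulPolar hψ (-k - 1).toNat b (limComponent k v)) =
        limEval J (limComponent k v) :=
    (Filter.eventually_all_finset _).2 fun k _ => eventually_mulPolar_eq hψ _ _ J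
  filter_upwards [h1] with b hb
  rw [← sub_eq_zero, ← map_sub, ← map_sub]
  refine integralComponent_weyl_eq_zero hψ hπ hJ fun k hk => ?_
  have hkm : k = -(((-k - 1).toNat : ℤ) + 1) := by
    rw [Finset.mem_Icc] at hk
    omega
  rw [map_sub, map_sub, sub_eq_zero, ← hb k hk]
  generalize (-k - 1).toNat = m at hkm
  subst hkm
  rw [limComponent_upsilonLim_unip]

theorem eventually_integralComponent_weyl_unip_inv
    (hπ : ∀ p, π (BorelPGL.toPGL p) = upsilonLim hψ p) {J : ℕ}
    (hJ : ∀ v : (MM F).prodInt.lim, v.1 J = 0 → (π (weylPGL _) v).1 0 = 0)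
    (hψ1 : ∃ z, ψ₀ z ≠ 1) (v : (MM F).prodInt.lim) : ∀ᶠ b in 𝓝[≠] (0 : F),
      integralComponent F (J + 2 : ℕ) (π (weylPGL _)
        (upsilonLim hψ ⟨1, ((PowerSeries.C b⁻¹ : F⟦X⟧) : F⸨X⸩)⟩ v)) = 0 := by
  have h1 : ∀ᶠ b in 𝓝[≠] (0 : F), ∀ k ∈ Finset.Icc (-(2 * J + 2) : ℤ) (-2),
      integralComponent F (J + 2 : ℕ) (π (weylPGL _) (limSingle k
        (mulPolar hψ ((-k - 2).toNat + 1) b⁻¹ (limComponent k v)))) = 0 := by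
    refine (Filter.eventually_all_finset _).2 fun k _ => ?_
    let Λ : (MM F).lim →ₗ[ℂ] ℂ := integralComponent F (J + 2 : ℕ) ∘ₗ π (weylPGL _) ∘ₗ limSingle k
    have hΛ : ∀ x, Λ x = integralComponent F (J + 2 : ℕ) (π (weylPGL _) (limSingle k x)) :=
      fun x => rfl
    have hΛJ : ∀ x : (MM F).lim, limEval J x = 0 → Λ x = 0 := by
      intro x hx
      rw [hΛ]
      refine integralComponent_weyl_eq_zero hψ hπ hJ fun n _ => ?_
      rw [limComponent_limSingle]
      by_cases h : n = k
      · subst h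
        rw [Pi.single_eq_same, hx]
      · rw [Pi.single_eq_of_ne h, map_zero]
    have hinv : ∀ (u : F⟦X⟧ˣ) (x : (MM F).lim), Λ (nuLim hψ u 0 x) = Λ x := by
      intro u x
      rw [hΛ, hΛ, integralComponent_weyl_limSingle hψ hπ]
    simp only [← hΛ]
    exact eventually_functional_mulPolar_eq_zero hψ hΛJ hinv hψ1 (-k - 2).toNat (limComponent k v)
  filter_upwards [h1] with b hb
  rw [integralComponent_weyl_eq_sum hψ hπ hJ]
  refine Finset.sum_eq_zero fun k hk => ?_
  rw [← hb k hk]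
  -- The bound k ≤ -2 makes the coefficient index -k - 1 positive, hence a successor as the
  -- vanishing lemma requires.
  have hkm : k = -((((-k - 2).toNat + 1 : ℕ) : ℤ) + 1) := by
    rw [Finset.mem_Icc] at hk
    omega
  generalize (-k - 2).toNat + 1 = m at hkm
  subst hkm
  rw [limComponent_upsilonLim_unip]

/-- The level-0 part of a pro-morphism is a germ, represented by a linear map on a single term. This
finiteness is lost for an arbitrary linear map of projective limits. -/
theorem exists_weyl_level (ρ : PGL(2, F⸨X⸩) →* End (MM F).prodInt) (g : PGL(2, F⸨X⸩)) :
    ∃ J, ∀ v : (MM F).prodInt.lim, v.1 J = 0 → ((MM F).prodInt.limEnd (ρ g) v).1 0 = 0 := by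
  obtain ⟨J, f, hf⟩ := ProVect.Germ.exists_of (ProVect.Hom.germ (ρ g) 0)
  refine ⟨J, fun v hv => ?_⟩
  rw [ProVect.limEnd_apply, ← hf, ProVect.Germ.eval_of, hv, map_zero]

end Extension

/-- The representation `Υ` of `P(K)` does not extend to a representation of `PGL₂(K)` on the same
pro-vector space, smooth or not. -/
theorem not_exists_extension_upsilon {F : Type u} [Field F] [ValuativeRel F] [TopologicalSpace F]
    [IsNonarchimedeanLocalField F] {ψ₀ : AddChar F ℂ} (hψ : IsLocallyConstant ψ₀)
    (hψ1 : ∃ z, ψ₀ z ≠ 1) :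
    ¬ ∃ ρ : PGL(2, F⸨X⸩) →* End (MM F).prodInt,
      ∀ p, ρ (BorelPGL.toPGL p) = (Upsilon hψ).ρ p := by
  rintro ⟨ρ, hρ⟩
  let π : PGL(2, F⸨X⸩) →* Module.End ℂ (MM F).prodInt.lim := (MM F).prodInt.limEnd.comp ρ
  have hπ : ∀ p, π (BorelPGL.toPGL p) = upsilonLim hψ p := fun p =>
    congrArg (MM F).prodInt.limEnd (hρ p)
  obtain ⟨J, hJ⟩ := exists_weyl_level ρ (weylPGL _)
  replace hJ : ∀ v : (MM F).prodInt.lim, v.1 J = 0 → (π (weylPGL _) v).1 0 = 0 := hJ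
  obtain ⟨m, hm⟩ := exists_limEval_one_eq_one (F := F)
  let v : (MM F).prodInt.lim := limOfComponents fun _ => m
  have hv : integralComponent F (J + 2 : ℕ) v = 1 := by
    rw [integralComponent_apply, limComponent_limOfComponents, hm]
  have := IsNonarchimedeanLocalField.nhdsNE_zero_neBot (F := F)
  -- One small nonzero `b` serves both limits: the first is applied to w v, where it returns the
  -- mass of w w v = v, the second to `v`, where it returns 0.
  obtain ⟨b, ⟨h1, h2⟩, hb⟩ :=
    (((eventually_integralComponent_weyl_unip hψ hπ hJ (π (weylPGL _) v)).filter_mono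
      nhdsWithin_le_nhds).and (eventually_integralComponent_weyl_unip_inv hψ hπ hJ hψ1 v)).and
      self_mem_nhdsWithin |>.exists
  have h3 := integralComponent_weyl_unip hψ hπ (J + 2) hb v
  rw [h1, h2, ← Module.End.mul_apply, ← map_mul, weylPGL_mul_self, map_one,
    Module.End.one_apply, hv] at h3
  exact one_ne_zero h3

theorem mainTheorem5 {F : Type u} [Field F] [ValuativeRel F] [TopologicalSpace F]
    [IsNonarchimedeanLocalField F] (hF : ringChar 𝓀[F] ≠ 2)
    (ψ₀ : AddChar F ℂ)
    (h₁ : ∀ x : F, ValuativeRel.valuation F x < 1 → ψ₀ x = 1)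
    (h₂ : ∃ x : F, ValuativeRel.valuation F x ≤ 1 ∧ ψ₀ x ≠ 1) :
    ¬ ∃ R : Action ProVect.{u} PGL(2, F⸨X⸩), IsSmooth R ∧
      Nonempty ((Action.res ProVect.{u} BorelPGL.toPGL).obj R ≅
        Upsilon (isLocallyConstant_of_trivial h₁)) := by
  rintro ⟨R, -, ⟨e⟩⟩
  obtain ⟨z, -, hz⟩ := h₂
  refine not_exists_extension_upsilon (isLocallyConstant_of_trivial h₁) ⟨z, hz⟩
    -- Conjugation by the given isomorphism transports the representation to the pro-vector space of
    -- Υ itself, where it extends Υ strictly.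
    ⟨(((Action.forget _ _).mapIso e).conj.toMonoidHom).comp R.ρ, fun p => ?_⟩
  exact (Action.Iso.conj_ρ e p).symm

end
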